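/- Let $\Phi$ be a reduced simply-laced root system of rank $r$ with Weyl group $W$, simple roots $\alpha_1,\dots,\alpha_r$, simple reflections $\sigma_1,\dots,\sigma_r$ and positive roots $\Phi^+$. Call $i\neq j$ adjacent if they are adjacent in the Dynkin diagram. For $\lambda=\sum_i k_i\alpha_i$ in the root lattice put $d(\lambda)=\sum_i k_i$ and $\mathbf{x}^\lambda=x_1^{k_1}\cdots x_r^{k_r}$. Let $q$ be a prime power, $\sqrt q$ its positive square root, $\ell=(l_1,\dots,l_r)$ an $r$-tuple of nonnegative integers, and $F=\mathbb{C}(x_1,\dots,x_r)$. For each $i$ let $\sigma_i\mathbf{x}=\mathbf{x}'$, where $x'_i=1/(qx_i)$, $x'_j=x_ix_j\sqrt q$ if $j$ is adjacent to $i$, and $x'_j=x_j$ otherwise; and let $\epsilon_i\mathbf{x}=\mathbf{x}''$, where $x''_j=-x_j$ if $j$ is adjacent to $i$ and $x''_j=x_j$ otherwise. For $f\in F$ put $f_{i,\ell}^{\pm}(\mathbf{x})=\tfrac12\bigl(f(\mathbf{x})\pm(-1)^{l_i}f(\epsilon_i\mathbf{x})\bigr)$ and $$(f|_\ell\sigma_i)(\mathbf{x})=-\frac{1-qx_i}{qx_i(1-x_i)}(x_i\sqrt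 q)^{l_i}f_{i,\ell}^{+}(\sigma_i\mathbf{x})+\frac{1}{x_i\sqrt q}(x_i\sqrt q)^{l_i}f_{i,\ell}^{-}(\sigma_i\mathbf{x}).$$ Then $f(\mathbf{x})\mapsto f(\sigma_i\mathbf{x})$ and $f\mapsto f|_\ell\sigma_i$ ($1\le i\le r$) extend uniquely to right actions $f(\mathbf{x})\mapsto f(w\mathbf{x})$ and $f\mapsto f|_\ell w$ of $W$ on $F$. Put $$\Delta(\mathbf{x})=\prod_{\alpha\in\Phi^+}\bigl(1-q^{d(\alpha)}\mathbf{x}^{2\alpha}\bigr),\qquad j(w,\mathbf{x})=\frac{\Delta(\mathbf{x})}{\Delta(w\mathbf{x})},\qquad f(\mathbf{x};\ell)=\Delta(\mathbf{x})^{-1}\sum_{w\in W}j(w,\mathbf{x})\,(1|_\ell w)(\mathbf{x}),$$ $$D(\mathbf{x})=\prod_{\alpha\in\Phi^+}\bigl(1-q^{d(\alpha)-1}\mathbf{x}^{2\alpha}\bigr),$$ and write $f(\mathbf{x};\ell)=N(\mathbf{x};\ell)/D(\mathbf{x})$. Then $N(\mathbf{x};\ell)$ is a polynomial, i.e. $N(\mathbf{x};\ell)\in\mathbb{C}[x_1,\dots,x_r]$.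 -/

import Mathlib

noncomputable section

namespace TwistedWeyl

/-! ### Rational functions and substitution of variables -/

/-- The field `ℂ(x_j : j ∈ σ)` of rational functions. -/
abbrev RatFun (σ : Type*) : Type _ := FractionRing (MvPolynomial σ ℂ)

/-- The variable `x_j` as a rational function. -/
def var {σ : Type*} (j : σ) : RatFun σ :=
  algebraMap (MvPolynomial σ ℂ) (RatFun σ) (MvPolynomial.X j)

lemma var_ne_zero {σ : Type*} (j : σ) : (var j : RatFun σ) ≠ 0 := by
  rw [var, ne_eq, FaithfulSMul.algebraMap_eq_zero_iff]
  exact MvPolynomial.X_ne_zero j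

/-- A tuple generating `ℂ(x)` as a field is algebraically independent (finitely many variables). -/
lemma algebraicIndependent_of_var_mem {σ : Type*} [Finite σ] (y : σ → RatFun σ)
    (h : ∀ j, var j ∈ IntermediateField.adjoin ℂ (Set.range y)) : AlgebraicIndependent ℂ y := by
  have top : IntermediateField.adjoin ℂ (Set.range y) = ⊤ := by
    rw [eq_top_iff]
    intro f _
    have hp : ∀ p : MvPolynomial σ ℂ, algebraMap (MvPolynomial σ ℂ) (RatFun σ) p ∈
        IntermediateField.adjoin ℂ (Set.range y) := by
      intro p
      induction p using MvPolynomial.induction_on with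
      | C a =>
        have : algebraMap (MvPolynomial σ ℂ) (RatFun σ) (MvPolynomial.C a) =
            algebraMap ℂ (RatFun σ) a := by
          rw [← MvPolynomial.algebraMap_eq, ← IsScalarTower.algebraMap_apply]
        rw [this]
        exact IntermediateField.algebraMap_mem _ a
      | add p q hp hq => rw [map_add]; exact add_mem hp hq
      | mul_X p i hp => rw [map_mul]; exact mul_mem hp (h i)
    obtain ⟨a, s, -, rfl⟩ := IsFractionRing.div_surjective (A := MvPolynomial σ ℂ) f
    exact div_mem (hp a) (hp s)
  have alg : Algebra.IsAlgebraic (Algebra.adjoin ℂ (Set.range y)) (RatFun σ) := by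
    refine ⟨fun f ↦ ?_⟩
    have hf : f ∈ IntermediateField.adjoin ℂ (Set.range y) := by rw [top]; trivial
    rw [IntermediateField.mem_adjoin_iff_div] at hf
    obtain ⟨r, hr, s, hs, rfl⟩ := hf
    have hr' := isAlgebraic_algebraMap (A := RatFun σ)
      (⟨r, hr⟩ : Algebra.adjoin ℂ (Set.range y))
    have hs' := isAlgebraic_algebraMap (A := RatFun σ)
      (⟨s, hs⟩ : Algebra.adjoin ℂ (Set.range y))
    rw [div_eq_mul_inv]
    exact hr'.mul hs'.inv
  refine (Algebra.IsAlgebraic.isTranscendenceBasis_of_lift_le_trdeg_of_finite ℂ y ?_).1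
  have h1 : Algebra.trdeg ℂ (MvPolynomial σ ℂ) ≤ Algebra.trdeg ℂ (RatFun σ) :=
    trdeg_le_of_injective (IsScalarTower.toAlgHom ℂ (MvPolynomial σ ℂ) (RatFun σ))
      (IsFractionRing.injective (MvPolynomial σ ℂ) (RatFun σ))
  rw [MvPolynomial.trdeg_of_isDomain] at h1
  simpa using h1

/-- The substitution `f(x) ↦ f(y)`, for an algebraically independent tuple `y` of rational
functions: the field homomorphism over `ℂ` with `x_j ↦ y_j`. -/
def substitute {σ : Type*} (y : σ → RatFun σ) (hy : AlgebraicIndependent ℂ y) :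
    RatFun σ →ₐ[ℂ] RatFun σ :=
  IsFractionRing.liftAlgHom (g := MvPolynomial.aeval y)
    (algebraicIndependent_iff_injective_aeval.mp hy)

lemma substitute_var {σ : Type*} (y : σ → RatFun σ) (hy : AlgebraicIndependent ℂ y) (j : σ) :
    substitute y hy (var j) = y j := by
  rw [substitute, IsFractionRing.liftAlgHom_apply, var, IsFractionRing.lift_algebraMap]
  exact MvPolynomial.aeval_X y j

/-! ### Root systems, the change of variables and the twisted action -/

section

variable {ι M N : Type*} [Finite ι] [AddCommGroup M] [Module ℝ M] [AddCommGroup N] [Module ℝ N]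
  {P : RootPairing ι ℝ M N}

/-- The Weyl group of a finite root system is finite. -/
instance finite_weylGroup [P.IsRootSystem] : Finite P.weylGroup := by
  refine Finite.of_injective (fun w : P.weylGroup ↦ P.weylGroupToPerm w) fun v w h ↦ ?_
  refine Subtype.ext (RootPairing.Equiv.weightHom_injective P (LinearEquiv.toLinearMap_injective ?_))
  refine LinearMap.ext_on_range (v := P.root) RootPairing.IsRootSystem.span_root_eq_top fun i ↦ ?_
  have hv := P.weylGroup_apply_root v i
  have hw := P.weylGroup_apply_root w i
  rw [show P.weylGroupToPerm v = P.weylGroupToPerm w from h] at hv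
  exact hv.trans hw.symm

/-- Two simple roots are adjacent in the Dynkin diagram. -/
def Adjacent [P.IsCrystallographic] (b : P.Base) (i j : b.support) : Prop :=
  i ≠ j ∧ b.cartanMatrix i j ≠ 0

open Classical in
/-- The tuple `σ_i x`. -/
def reflectTuple [P.IsCrystallographic] (b : P.Base) (q : ℕ) (i j : b.support) :
    RatFun b.support :=
  if j = i then 1 / ((q : RatFun b.support) * var j)
  else if Adjacent b i j then var i * var j * algebraMap ℂ (RatFun b.support) (Real.sqrt q : ℂ)
  else var j

open Classical in
/-- The tuple `ε_i x`. -/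
def signTuple [P.IsCrystallographic] (b : P.Base) (i j : b.support) : RatFun b.support :=
  if Adjacent b i j then - var j else var j

lemma reflectTuple_algebraicIndependent [P.IsCrystallographic] (b : P.Base) {q : ℕ}
    (hq : IsPrimePow q) (i : b.support) : AlgebraicIndependent ℂ (reflectTuple b q i) := by
  have hq0 : (q : RatFun b.support) ≠ 0 := Nat.cast_ne_zero.mpr hq.ne_zero
  have hs0 : algebraMap ℂ (RatFun b.support) (Real.sqrt q : ℂ) ≠ 0 := by
    rw [ne_eq, FaithfulSMul.algebraMap_eq_zero_iff, Complex.ofReal_eq_zero, Real.sqrt_eq_zero',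
      not_le]
    exact_mod_cast hq.pos
  set K := IntermediateField.adjoin ℂ (Set.range (reflectTuple b q i))
  have hmem : ∀ j, reflectTuple b q i j ∈ K := fun j ↦
    IntermediateField.subset_adjoin ℂ _ (Set.mem_range_self j)
  have hi : var i ∈ K := by
    have h1 := hmem i
    rw [reflectTuple, if_pos rfl] at h1
    have h2 : (var i : RatFun b.support) = (1 / ((q : RatFun b.support) * var i))⁻¹ * (q : RatFun b.support)⁻¹ := by
      have := var_ne_zero i
      field_simp
    rw [h2]
    exact mul_mem (inv_mem h1) (inv_mem (natCast_mem K q))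
  refine algebraicIndependent_of_var_mem _ fun j ↦ ?_
  have hj := hmem j
  rw [reflectTuple] at hj
  split_ifs at hj with h1 h2
  · rw [h1]; exact hi
  · have h3 : (var j : RatFun b.support) =
        (var i * var j * algebraMap ℂ (RatFun b.support) (Real.sqrt q : ℂ)) * (var i)⁻¹ *
          (algebraMap ℂ (RatFun b.support) (Real.sqrt q : ℂ))⁻¹ := by
      have := var_ne_zero i
      field_simp
    rw [h3]
    exact mul_mem (mul_mem hj (inv_mem hi)) (inv_mem (K.algebraMap_mem _))
  · exact hj

lemma signTuple_algebraicIndependent [P.IsCrystallographic] (b : P.Base) (i : b.support) :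
    AlgebraicIndependent ℂ (signTuple b i) := by
  refine algebraicIndependent_of_var_mem _ fun j ↦ ?_
  have hj := IntermediateField.subset_adjoin ℂ _ (Set.mem_range_self (f := signTuple b i) j)
  rw [SetLike.mem_coe, signTuple] at hj
  split_ifs at hj
  · simpa using neg_mem hj
  · exact hj

/-- The field automorphism `f(x) ↦ f(σ_i x)`. -/
def reflectSubst [P.IsCrystallographic] (b : P.Base) {q : ℕ} (hq : IsPrimePow q) (i : b.support) :
    RatFun b.support →ₐ[ℂ] RatFun b.support :=
  substitute (reflectTuple b q i) (reflectTuple_algebraicIndependent b hq i)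

/-- The field automorphism `f(x) ↦ f(ε_i x)`. -/
def signSubst [P.IsCrystallographic] (b : P.Base) (i : b.support) :
    RatFun b.support →ₐ[ℂ] RatFun b.support :=
  substitute (signTuple b i) (signTuple_algebraicIndependent b i)

/-- `f_{i,ℓ}^+ (x) = (f(x) + (-1)^{l_i} f(ε_i x)) / 2`. -/
def plusPart [P.IsCrystallographic] (b : P.Base) (l : b.support → ℕ) (i : b.support)
    (f : RatFun b.support) : RatFun b.support :=
  (f + (-1) ^ l i * signSubst b i f) / 2

/-- `f_{i,ℓ}^- (x) = (f(x) - (-1)^{l_i} f(ε_i x)) / 2`. -/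
def minusPart [P.IsCrystallographic] (b : P.Base) (l : b.support → ℕ) (i : b.support)
    (f : RatFun b.support) : RatFun b.support :=
  (f - (-1) ^ l i * signSubst b i f) / 2

/-- The `ℓ`-twisted operator `f ↦ f |_ℓ σ_i` of a simple reflection `σ_i`. -/
def simpleSlash [P.IsCrystallographic] (b : P.Base) {q : ℕ} (hq : IsPrimePow q)
    (l : b.support → ℕ) (i : b.support) (f : RatFun b.support) : RatFun b.support :=
  let Q : RatFun b.support := (q : RatFun b.support)
  let s : RatFun b.support := algebraMap ℂ (RatFun b.support) (Real.sqrt q : ℂ)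
  let x : RatFun b.support := var i;
  -((1 - Q * x) / (Q * x * (1 - x))) * (x * s) ^ l i * reflectSubst b hq i (plusPart b l i f)
    + 1 / (x * s) * (x * s) ^ l i * reflectSubst b hq i (minusPart b l i f)

/-- `A` is a right action of the Weyl group on `ℂ(x)`, written `(f, w) ↦ A w f`, in which every
simple reflection `σ_i` acts by the given operator `t i`. -/
structure IsRightActionExtending (b : P.Base)
    (t : b.support → RatFun b.support → RatFun b.support)
    (A : P.weylGroup → RatFun b.support → RatFun b.support) : Prop where
  one : ∀ f, A 1 f = f
  mul : ∀ v w f, A (v * w) f = A w (A v f)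
  simple : ∀ (i : b.support) f, A (RootPairing.weylGroup.ofIdx P (i : ι)) f = t i f

/-- The monomial `x^λ = ∏ x_j^{k_j}` for `λ = ∑ k_j α_j` in the root lattice. -/
def monomial (b : P.Base) (v : P.rootSpan ℤ) : RatFun b.support :=
  ∏ j : b.support, (var j : RatFun b.support) ^ (b.toWeightBasisInt.repr v j : ℤ)

end

section

variable {ι M N : Type*} [Fintype ι] [AddCommGroup M] [Module ℝ M] [AddCommGroup N] [Module ℝ N]
  {P : RootPairing ι ℝ M N}

open Classical in
/-- `Δ(x) = ∏_{α > 0} (1 - q^{d(α)} x^{2α})`, where `d` is the height. -/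
def Delta (b : P.Base) (q : ℕ) : RatFun b.support :=
  ∏ a : ι with b.IsPos a,
    (1 - (q : RatFun b.support) ^ b.height a * monomial b (2 • P.rootSpanMem ℤ a))

open Classical in
/-- `D(x) = ∏_{α > 0} (1 - q^{d(α) - 1} x^{2α})`. -/
def denom (b : P.Base) (q : ℕ) : RatFun b.support :=
  ∏ a : ι with b.IsPos a,
    (1 - (q : RatFun b.support) ^ (b.height a - 1) * monomial b (2 • P.rootSpanMem ℤ a))

/-- Given the right actions `S`, `f(x) ↦ f(w x)`, and `A`, `f ↦ f |_ℓ w`, of the Weyl group, the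
average `f(x; ℓ) = Δ(x)⁻¹ ∑_w j(w, x) (1 |_ℓ w)(x)` with `j(w, x) = Δ(x) / Δ(w x)`. -/
def average [P.IsRootSystem] (b : P.Base) (q : ℕ)
    (S A : P.weylGroup → RatFun b.support → RatFun b.support) : RatFun b.support :=
  letI : Fintype P.weylGroup := Fintype.ofFinite _
  (Delta b q)⁻¹ * ∑ w : P.weylGroup, Delta b q / S w (Delta b q) * A w 1

end

end TwistedWeyl

end

/-! Put `y_j = √q x_j` and, for a root `a`, let `Y_a` be the monomial with exponents `a` in the
`y_j`. Then `σ_i` sends `Y_a` to `Y_{s_i a}`, every `ε_i` multiplies `Y_a` by a sign, and `Δ = ∏ (1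
- Y_a²)`, `D = ∏ (1 - Y_a²/q)` over the positive roots. The twisted operator becomes `c(y_i) f(σ_i
x) + d(y_i) f(ε_i σ_i x)` with explicit scalars `c` and `d`. The involution, commutation and braid
relations are then monomial or scalar identities, and Matsumoto's theorem (`descentLift_mul_ofIdx`)
yields both actions; they are unique because simple reflections generate `W`.

Let `f` be the average and `F = D Δ f`. Here `Δ(x)/Δ(wx) = ± ∏ Y_a²` over the inversions `a` of `w`,
and `∏ Y_a (1 - Y_a²/q)` over the same roots clears the denominators of `1|w` (`slash_one_mem`), so
`F` is a polynomial. It remains to see that `Δ` divides it.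

Reindexing the sum over `W` gives `f|σ_i = f` (`simpleSlash_average`), hence a functional equation
for `F`. On `y_i = 1` the substitution `σ_i` restricts to the identity and on `y_i = -1` to `ε_i`;
in both cases the equation collapses to `4(q - 1) F = 0`. So `f` has no pole along the simple
divisors `y_i² = 1` (`mem_regularAtSimple_of_invariant`).

The other divisors `Y_a² = 1` are images of simple ones under reflections. Invariance expresses `σ_j
f` through `f` and `ε_j f`, with coefficients whose denominators are only monomials and factors `1 -
Y_a²/q`. Thus `f` lies in an algebra that is stable under all `σ_j` and regular along the simple
divisors (`orbitAlgebra`), and regularity spreads to every root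
(`mem_laurent_of_mul_rootFactor_mem`). Hence `f D` is a Laurent polynomial. Since `f D = F/Δ` and
`Δ` does not vanish identically on `x_i = 0`, it has no pole there either and is a polynomial. -/

noncomputable section

namespace TwistedWeyl

open RootPairing

/-! ### Relations and generation in the Weyl group -/

section WeylGroup

variable {ι M N : Type*} [AddCommGroup M] [Module ℝ M] [AddCommGroup N] [Module ℝ N]
  {P : RootPairing ι ℝ M N}

/-- The roots span, so an identity in `W` may be checked on roots; the relations below are all
obtained this way. -/
lemma weylGroupToPerm_injective [P.IsRootSystem] : Function.Injective P.weylGroupToPerm := by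
  intro v w h
  refine Subtype.ext (RootPairing.Equiv.weightHom_injective P (LinearEquiv.toLinearMap_injective ?_))
  refine LinearMap.ext_on_range (v := P.root) RootPairing.IsRootSystem.span_root_eq_top fun i ↦ ?_
  have hv := P.weylGroup_apply_root v i
  have hw := P.weylGroup_apply_root w i
  rw [h] at hv
  exact hv.trans hw.symm

lemma weylGroupToPerm_ofIdx (i : ι) :
    P.weylGroupToPerm (weylGroup.ofIdx P i) = P.reflectionPerm i := rfl

lemma weylGroupToPerm_mul_ofIdx (w : P.weylGroup) (i a : ι) :
    P.weylGroupToPerm (w * weylGroup.ofIdx P i) a = P.weylGroupToPerm w (P.reflectionPerm i a) := by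
  rw [map_mul]; rfl

lemma root_weylGroupToPerm_mul_ofIdx (w : P.weylGroup) (i a : ι) :
    P.root (P.weylGroupToPerm (w * weylGroup.ofIdx P i) a) =
      P.root (P.weylGroupToPerm w a) - P.pairing a i • P.root (P.weylGroupToPerm w i) := by
  rw [weylGroupToPerm_mul_ofIdx, ← P.weylGroup_apply_root, root_reflectionPerm,
    reflection_apply_root, smul_sub, P.weylGroup_apply_root, smul_comm, P.weylGroup_apply_root]

lemma ofIdx_mul_self [P.IsRootSystem] (i : ι) :
    weylGroup.ofIdx P i * weylGroup.ofIdx P i = 1 := by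
  apply weylGroupToPerm_injective
  rw [map_mul, map_one, weylGroupToPerm_ofIdx]
  ext a
  simp

lemma mul_ofIdx_mul_ofIdx [P.IsRootSystem] (w : P.weylGroup) (i : ι) :
    w * weylGroup.ofIdx P i * weylGroup.ofIdx P i = w := by
  rw [mul_assoc, ofIdx_mul_self, mul_one]

lemma ofIdx_mul_comm [P.IsRootSystem] {i j : ι} (hij : P.pairing i j = 0) (hji : P.pairing j i = 0) :
    weylGroup.ofIdx P i * weylGroup.ofIdx P j = weylGroup.ofIdx P j * weylGroup.ofIdx P i := by
  apply weylGroupToPerm_injective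
  ext a
  apply P.root.injective
  rw [root_weylGroupToPerm_mul_ofIdx, root_weylGroupToPerm_mul_ofIdx]
  simp only [weylGroupToPerm_ofIdx, root_reflectionPerm, reflection_apply_root, hij, hji]
  module

lemma ofIdx_braid [P.IsRootSystem] {i j : ι} (hij : P.pairing i j = -1)
    (hji : P.pairing j i = -1) :
    weylGroup.ofIdx P i * weylGroup.ofIdx P j * weylGroup.ofIdx P i =
      weylGroup.ofIdx P j * weylGroup.ofIdx P i * weylGroup.ofIdx P j := by
  apply weylGroupToPerm_injective
  ext a
  apply P.root.injective
  simp only [root_weylGroupToPerm_mul_ofIdx, weylGroupToPerm_ofIdx, root_reflectionPerm,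
    reflection_apply_root, hij, hji, pairing_same]
  module

lemma ofIdx_reflectionPerm [P.IsRootSystem] (i j : ι) :
    weylGroup.ofIdx P (P.reflectionPerm j i) =
      weylGroup.ofIdx P j * weylGroup.ofIdx P i * weylGroup.ofIdx P j := by
  apply weylGroupToPerm_injective
  ext a
  apply P.root.injective
  simp only [weylGroupToPerm_mul_ofIdx, weylGroupToPerm_ofIdx, root_reflectionPerm,
    reflection_reflectionPerm]
  rfl

variable [Finite ι] [P.IsCrystallographic] [P.IsReduced]

/-- A property of Weyl group elements that holds at `1` and is stable under multiplication by simple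
reflections on the right holds everywhere. -/
lemma weylGroup_induction_simple [P.IsRootSystem] (b : P.Base) {p : P.weylGroup → Prop}
    (one : p 1) (mul : ∀ w (i : b.support), p w → p (w * weylGroup.ofIdx P (i : ι)))
    (w : P.weylGroup) : p w := by
  set H : Subgroup P.weylGroup :=
    Subgroup.closure (Set.range fun i : b.support ↦ weylGroup.ofIdx P (i : ι))
  have hH : ∀ i, weylGroup.ofIdx P i ∈ H := fun i ↦ by
    refine b.induction_reflect i (p := fun i ↦ weylGroup.ofIdx P i ∈ H) ?_ ?_ ?_
    · intro i hi
      rw [ofIdx_reflectionPerm]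
      exact mul_mem (mul_mem hi hi) hi
    · exact fun i hi ↦ Subgroup.subset_closure ⟨⟨i, hi⟩, rfl⟩
    · intro i j hi hj
      have hj' : weylGroup.ofIdx P j ∈ H := Subgroup.subset_closure ⟨⟨j, hj⟩, rfl⟩
      rw [ofIdx_reflectionPerm]
      exact mul_mem (mul_mem hj' hi) hj'
  have hw : w ∈ H := by
    obtain ⟨w, hw⟩ := w
    induction hw using weylGroup.induction with
    | mem i => exact hH i
    | one => exact one_mem H
    | mul x y hx hy hx' hy' => exact mul_mem hx' hy'
  induction hw using Subgroup.closure_induction_right with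
  | one => exact one
  | mul_right x hx y hy h =>
    obtain ⟨i, rfl⟩ := hy
    exact mul x i h
  | mul_inv_cancel x hx y hy h =>
    obtain ⟨i, rfl⟩ := hy
    rw [inv_eq_of_mul_eq_one_left (ofIdx_mul_self (i : ι))]
    exact mul x i h

end WeylGroup

/-! ### Inversions, Matsumoto's theorem and extension to actions -/

section Inversions

variable {ι M N : Type*} [Fintype ι] [AddCommGroup M] [Module ℝ M] [AddCommGroup N] [Module ℝ N]
  {P : RootPairing ι ℝ M N} (b : P.Base)

open Classical in
/-- The positive roots made negative by `w`. -/
def inversions (w : P.weylGroup) : Finset ι :=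
  {a | b.IsPos a ∧ ¬ b.IsPos (P.weylGroupToPerm w a)}

variable {b}

lemma mem_inversions {w : P.weylGroup} {a : ι} :
    a ∈ inversions b w ↔ b.IsPos a ∧ ¬ b.IsPos (P.weylGroupToPerm w a) := by
  classical
  simp only [inversions, Finset.mem_filter, Finset.mem_univ, true_and]

omit [Fintype ι] in
lemma isPos_reflectionPerm_self_iff (w : P.weylGroup) (i : ι) :
    b.IsPos (P.weylGroupToPerm w (P.reflectionPerm i i)) ↔ ¬ b.IsPos (P.weylGroupToPerm w i) := by
  have h : P.root (P.weylGroupToPerm w (P.reflectionPerm i i)) =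
      P.root (P.reflectionPerm (P.weylGroupToPerm w i) (P.weylGroupToPerm w i)) := by
    rw [← weylGroupToPerm_mul_ofIdx, root_weylGroupToPerm_mul_ofIdx]
    simp only [pairing_same, root_reflectionPerm, reflection_apply_self]
    module
  rw [P.root.injective h]
  exact Base.IsPos.neg_iff_not b _

omit [Fintype ι] in
lemma not_isPos_reflectionPerm_self {i : ι} (hi : i ∈ b.support) :
    ¬ b.IsPos (P.reflectionPerm i i) := by
  rw [show b.IsPos (P.reflectionPerm i i) ↔ ¬ b.IsPos i from Base.IsPos.neg_iff_not b i, not_not]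
  exact Base.isPos_of_mem_support hi

lemma notMem_map_inversions {w : P.weylGroup} {i : ι} (hi : i ∈ b.support) :
    i ∉ (inversions b w).map (P.reflectionPerm i).toEmbedding := by
  intro h
  obtain ⟨a, ha, hai⟩ := Finset.mem_map.mp h
  have h1 := (mem_inversions.mp ha).1
  have ha : a = P.reflectionPerm i i := by
    rw [← P.reflectionPerm_self i a]
    exact congrArg _ hai
  exact not_isPos_reflectionPerm_self hi (ha ▸ h1)

variable [P.IsCrystallographic] [P.IsReduced]

open Classical in
-- A simple reflection permutes the positive roots other than its own, and `w s_i` sends `α_i` to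
-- `-w α_i`.
lemma inversions_mul_ofIdx {w : P.weylGroup} {i : ι} (hi : i ∈ b.support)
    (hw : b.IsPos (P.weylGroupToPerm w i)) :
    inversions b (w * weylGroup.ofIdx P i) =
      insert i ((inversions b w).map (P.reflectionPerm i).toEmbedding) := by
  ext a
  have key : a ∈ (inversions b w).map (P.reflectionPerm i).toEmbedding ↔
      P.reflectionPerm i a ∈ inversions b w := by
    rw [Finset.mem_map_equiv, P.reflectionPerm_symm]
  rw [Finset.mem_insert, key, mem_inversions, mem_inversions, weylGroupToPerm_mul_ofIdx]
  by_cases hai : a = i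
  · rw [hai]
    simp only [true_or, iff_true]
    refine ⟨Base.isPos_of_mem_support hi, ?_⟩
    rwa [isPos_reflectionPerm_self_iff, not_not]
  · simp only [hai, false_or, and_congr_left_iff]
    intro hn
    refine ⟨fun h ↦ h.reflectionPerm hi hai, fun h ↦ ?_⟩
    have hne : P.reflectionPerm i a ≠ i := fun hc ↦ hn (by rwa [hc])
    simpa using h.reflectionPerm hi hne

lemma card_inversions_mul_ofIdx {w : P.weylGroup} {i : ι} (hi : i ∈ b.support)
    (hw : b.IsPos (P.weylGroupToPerm w i)) :
    (inversions b (w * weylGroup.ofIdx P i)).card = (inversions b w).card + 1 := by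
  classical
  rw [inversions_mul_ofIdx hi hw, Finset.card_insert_of_notMem (notMem_map_inversions hi),
    Finset.card_map]

variable [P.IsRootSystem]

lemma card_inversions_of_not_isPos {w : P.weylGroup} {i : ι} (hi : i ∈ b.support)
    (hw : ¬ b.IsPos (P.weylGroupToPerm w i)) :
    (inversions b w).card = (inversions b (w * weylGroup.ofIdx P i)).card + 1 := by
  rw [← card_inversions_mul_ofIdx hi, mul_ofIdx_mul_ofIdx]
  rwa [weylGroupToPerm_mul_ofIdx, isPos_reflectionPerm_self_iff]

open Classical in
/-- The composite of the operators `t i` along a word for `w` obtained by removing descents. -/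
def descentLift {ι M N : Type*} [Fintype ι] [AddCommGroup M] [Module ℝ M] [AddCommGroup N]
    [Module ℝ N] {P : RootPairing ι ℝ M N} [P.IsCrystallographic] [P.IsReduced] [P.IsRootSystem]
    (b : P.Base) {X : Type*} (t : b.support → X → X) (w : P.weylGroup) : X → X :=
  if h : ∃ i : b.support, ¬ b.IsPos (P.weylGroupToPerm w i) then
    t h.choose ∘ descentLift b t (w * weylGroup.ofIdx P (h.choose : ι))
  else id
termination_by (inversions b w).card
decreasing_by
  rw [card_inversions_of_not_isPos h.choose.2 h.choose_spec]
  exact Nat.lt_succ_self _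

section Lift

variable {X : Type*} {t : b.support → X → X}

lemma descentLift_of_forall_isPos {w : P.weylGroup}
    (h : ∀ i : b.support, b.IsPos (P.weylGroupToPerm w i)) : descentLift b t w = id := by
  rw [descentLift, dif_neg]
  push Not
  exact h

omit [Fintype ι] [P.IsReduced] [P.IsRootSystem] in
lemma pairing_of_cartanMatrix_eq {i j : b.support} {z : ℤ} (h : b.cartanMatrix i j = z) :
    P.pairing i j = z := by
  rw [← h, ← P.algebraMap_pairingIn ℤ]; rfl

omit [Fintype ι] [P.IsReduced] [P.IsRootSystem] in
lemma cartanMatrix_symm (hsl : b.cartanMatrix.IsSimplyLaced) {i j : b.support} (hij : i ≠ j)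
    (h : b.cartanMatrix i j = -1) : b.cartanMatrix j i = -1 := by
  refine (hsl hij.symm).resolve_left fun h0 ↦ ?_
  rw [b.cartanMatrix_apply_eq_zero_iff_symm.mp h0] at h
  omega

omit [Fintype ι] [P.IsReduced] [P.IsRootSystem] in
lemma height_mul_ofIdx {w : P.weylGroup} {i j : b.support} {z : ℤ}
    (h : b.cartanMatrix j i = z) :
    b.height (P.weylGroupToPerm (w * weylGroup.ofIdx P (i : ι)) j) =
      b.height (P.weylGroupToPerm w j) - z * b.height (P.weylGroupToPerm w i) := by
  have := root_weylGroupToPerm_mul_ofIdx w (i : ι) (j : ι)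
  rw [pairing_of_cartanMatrix_eq h, Int.cast_smul_eq_zsmul, sub_eq_add_neg, ← neg_smul] at this
  rw [b.height_add_zsmul this]
  simp only [smul_eq_mul]
  ring

/-- Matsumoto's theorem for simply-laced root systems: the operators attached to words in the simple
reflections depend only on the Weyl group element. -/
lemma descentLift_mul_ofIdx (hsl : b.cartanMatrix.IsSimplyLaced)
    (invol : ∀ i x, t i (t i x) = x)
    (comm : ∀ i j, i ≠ j → b.cartanMatrix i j = 0 → ∀ x, t i (t j x) = t j (t i x))
    (braid : ∀ i j, i ≠ j → b.cartanMatrix i j = -1 → ∀ x, t i (t j (t i x)) = t j (t i (t j x)))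
    (w : P.weylGroup) (i : b.support) :
    descentLift b t (w * weylGroup.ofIdx P (i : ι)) = t i ∘ descentLift b t w := by
  set T := descentLift b t
  set s : b.support → P.weylGroup := fun i ↦ weylGroup.ofIdx P (i : ι) with hs
  have hinv : ∀ w i, w * s i * s i = w := fun w i ↦ mul_ofIdx_mul_ofIdx w i
  have hss : ∀ (w : P.weylGroup) (i : b.support),
      b.height (P.weylGroupToPerm (w * s i) i) = - b.height (P.weylGroupToPerm w i) := by
    intro w i
    rw [height_mul_ofIdx (b.cartanMatrix_apply_same i)]
    ring
  -- Removing an arbitrary descent is enough: an ascent `i` of `w` is a descent of `w s_i`, and at a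
  -- descent the two copies of `t i` cancel.
  suffices key : ∀ n (w : P.weylGroup), (inversions b w).card = n → ∀ i : b.support,
      ¬ b.IsPos (P.weylGroupToPerm w i) → T w = t i ∘ T (w * s i) by
    by_cases hi : b.IsPos (P.weylGroupToPerm w i)
    · rw [key _ _ rfl i, hinv]
      rwa [weylGroupToPerm_mul_ofIdx, isPos_reflectionPerm_self_iff, not_not]
    · rw [key _ _ rfl i hi]
      funext x
      exact (invol i _).symm
  intro n
  induction n using Nat.strongRecOn with
  | ind n ih =>
    intro w hn i hi
    have lt : ∀ (v : P.weylGroup) (j : b.support), ¬ b.IsPos (P.weylGroupToPerm v j) →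
        (inversions b (v * s j)).card < (inversions b v).card := fun v j hj ↦ by
      rw [card_inversions_of_not_isPos j.2 hj]
      exact Nat.lt_succ_self _
    have hex : ∃ i : b.support, ¬ b.IsPos (P.weylGroupToPerm w i) := ⟨i, hi⟩
    -- `j` is the descent picked by the definition of `descentLift`; it has to be compared with the
    -- given descent `i`.
    obtain ⟨j, hj, hT⟩ : ∃ j : b.support, ¬ b.IsPos (P.weylGroupToPerm w j) ∧
        T w = t j ∘ T (w * s j) :=
      ⟨hex.choose, hex.choose_spec, by
        change descentLift b t w = _
        rw [descentLift, dif_pos hex]⟩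
    by_cases hij : i = j
    · rw [hij, hT]
    have hji : j ≠ i := Ne.symm hij
    have step : ∀ v : P.weylGroup, (inversions b v).card < n → ∀ k : b.support,
        ¬ b.IsPos (P.weylGroupToPerm v k) → T v = t k ∘ T (v * s k) :=
      fun v hv k hk ↦ ih _ hv v rfl k hk
    have hwi := lt w i hi
    have hwj := lt w j hj
    rw [hn] at hwi hwj
    -- Positivity of a root is positivity of its height, and heights never vanish, so descents are
    -- decided by linear arithmetic.
    have ne0 := fun (v : P.weylGroup) (k : b.support) ↦ b.height_ne_zero (P.weylGroupToPerm v k)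
    -- As `i` and `j` are both descents, the whole longest word in `s_i, s_j` can be removed from
    -- `w`. Both orders of removal end at the same element, and the operators collected on the way
    -- agree by `comm` or `braid`.
    rcases hsl hij with h0 | h1
    · have h0' := b.cartanMatrix_apply_eq_zero_iff_symm.mp h0
      have d1 : ¬ b.IsPos (P.weylGroupToPerm (w * s i) j) := by
        rw [Base.isPos_iff] at *
        rw [height_mul_ofIdx h0']
        omega
      have d2 : ¬ b.IsPos (P.weylGroupToPerm (w * s j) i) := by
        rw [Base.isPos_iff] at *
        rw [height_mul_ofIdx h0]
        omega
      have hc : w * s i * s j = w * s j * s i := by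
        rw [mul_assoc, mul_assoc, hs]
        dsimp only
        rw [ofIdx_mul_comm (by simpa using pairing_of_cartanMatrix_eq h0)
          (by simpa using pairing_of_cartanMatrix_eq h0')]
      rw [hT, step _ hwi j d1, step _ hwj i d2, hc]
      funext x
      exact comm j i hji h0' _
    · have h1' := cartanMatrix_symm hsl hij h1
      have d1 : ¬ b.IsPos (P.weylGroupToPerm (w * s i) j) := by
        rw [Base.isPos_iff] at *
        rw [height_mul_ofIdx h1']
        omega
      have d2 : ¬ b.IsPos (P.weylGroupToPerm (w * s j) i) := by
        rw [Base.isPos_iff] at *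
        rw [height_mul_ofIdx h1]
        omega
      have e1 : ¬ b.IsPos (P.weylGroupToPerm (w * s i * s j) i) := by
        rw [Base.isPos_iff] at *
        rw [height_mul_ofIdx h1, hss, height_mul_ofIdx h1']
        omega
      have e2 : ¬ b.IsPos (P.weylGroupToPerm (w * s j * s i) j) := by
        rw [Base.isPos_iff] at *
        rw [height_mul_ofIdx h1', hss, height_mul_ofIdx h1]
        omega
      have hc : w * s i * s j * s i = w * s j * s i * s j := by
        have := ofIdx_braid (P := P) (i := (i : ι)) (j := (j : ι))
          (by simpa using pairing_of_cartanMatrix_eq h1)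
          (by simpa using pairing_of_cartanMatrix_eq h1')
        simp only [hs, mul_assoc] at this ⊢
        rw [this]
      rw [hT, step _ hwi j d1, step _ hwj i d2, step _ ((lt _ _ d1).trans hwi) i e1,
        step _ ((lt _ _ d2).trans hwj) j e2, hc]
      funext x
      exact braid j i hji h1' _

end Lift

/-- Matsumoto's theorem is applied to right multiplication on `W` itself: the operator attached to
`w` sends `1` to `w`, but without descents it is the identity. -/
lemma eq_one_of_forall_isPos (hsl : b.cartanMatrix.IsSimplyLaced) {w : P.weylGroup}
    (h : ∀ i : b.support, b.IsPos (P.weylGroupToPerm w i)) : w = 1 := by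
  let t : b.support → P.weylGroup → P.weylGroup := fun i v ↦ v * weylGroup.ofIdx P (i : ι)
  have key : ∀ v, descentLift b t v 1 = v := by
    refine weylGroup_induction_simple b ?_ fun v i hv ↦ ?_
    · rw [descentLift_of_forall_isPos]
      · rfl
      · intro i
        rw [map_one]
        exact Base.isPos_of_mem_support i.2
    · rw [descentLift_mul_ofIdx hsl]
      · rw [Function.comp_apply, hv]
      · intro i x
        exact mul_ofIdx_mul_ofIdx x i
      · intro i j hij h0 x
        simp only [t, mul_assoc]
        rw [ofIdx_mul_comm
          (by simpa using pairing_of_cartanMatrix_eq (b.cartanMatrix_apply_eq_zero_iff_symm.mp h0))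
          (by simpa using pairing_of_cartanMatrix_eq h0)]
      · intro i j hij h1 x
        have := ofIdx_braid (P := P) (i := (i : ι)) (j := (j : ι))
          (by simpa using pairing_of_cartanMatrix_eq h1)
          (by simpa using pairing_of_cartanMatrix_eq (cartanMatrix_symm hsl hij h1))
        simp only [t, mul_assoc] at this ⊢
        rw [this]
  rw [← key w, descentLift_of_forall_isPos h, id]

/-- Induction along right multiplications by simple reflections that increase the length. -/
lemma weylGroup_induction_ascent (hsl : b.cartanMatrix.IsSimplyLaced) {p : P.weylGroup → Prop}
    (one : p 1) (mul : ∀ w (i : b.support), b.IsPos (P.weylGroupToPerm w i) → p w →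
      p (w * weylGroup.ofIdx P (i : ι)))
    (w : P.weylGroup) : p w := by
  generalize hn : (inversions b w).card = n
  induction n generalizing w with
  | zero =>
    have h : w = 1 := eq_one_of_forall_isPos hsl fun i ↦ by
      by_contra hi
      rw [card_inversions_of_not_isPos i.2 hi] at hn
      omega
    exact h ▸ one
  | succ n ih =>
    by_cases h : ∀ i : b.support, b.IsPos (P.weylGroupToPerm w i)
    · rw [eq_one_of_forall_isPos hsl h]
      exact one
    · push Not at h
      obtain ⟨i, hi⟩ := h
      rw [← mul_ofIdx_mul_ofIdx w i]
      refine mul _ i ?_ (ih _ ?_)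
      · rwa [weylGroupToPerm_mul_ofIdx, isPos_reflectionPerm_self_iff]
      · rw [card_inversions_of_not_isPos i.2 hi] at hn
        omega

/-- Matsumoto's recursion is multiplicativity for one simple reflection; induction on the second
factor gives the rest. -/
lemma isRightActionExtending_descentLift (hsl : b.cartanMatrix.IsSimplyLaced)
    {t : b.support → RatFun b.support → RatFun b.support}
    (invol : ∀ i x, t i (t i x) = x)
    (comm : ∀ i j, i ≠ j → b.cartanMatrix i j = 0 → ∀ x, t i (t j x) = t j (t i x))
    (braid : ∀ i j, i ≠ j → b.cartanMatrix i j = -1 →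
      ∀ x, t i (t j (t i x)) = t j (t i (t j x))) :
    IsRightActionExtending b t (descentLift b t) := by
  have h1 : descentLift b t 1 = id := descentLift_of_forall_isPos fun i ↦ by
    rw [map_one]
    exact Base.isPos_of_mem_support i.2
  have hm := descentLift_mul_ofIdx hsl invol comm braid
  refine ⟨fun f ↦ by rw [h1]; rfl, fun v w f ↦ ?_, fun i f ↦ ?_⟩
  · induction w using weylGroup_induction_simple b with
    | one => rw [mul_one, h1]; rfl
    | mul w i ih => rw [← mul_assoc, hm, hm, Function.comp_apply, Function.comp_apply, ih]
  · rw [← one_mul (weylGroup.ofIdx P (i : ι)), hm, h1]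
    rfl

omit [Fintype ι] [P.IsCrystallographic] [P.IsReduced] [P.IsRootSystem] in
lemma IsRightActionExtending.mul_ofIdx
    {t : b.support → RatFun b.support → RatFun b.support}
    {A : P.weylGroup → RatFun b.support → RatFun b.support} (hA : IsRightActionExtending b t A)
    (w : P.weylGroup) (i : b.support) (f : RatFun b.support) :
    A (w * weylGroup.ofIdx P (i : ι)) f = t i (A w f) := by
  rw [hA.mul, hA.simple]

lemma IsRightActionExtending.unique
    {t : b.support → RatFun b.support → RatFun b.support}
    {A B : P.weylGroup → RatFun b.support → RatFun b.support}
    (hA : IsRightActionExtending b t A) (hB : IsRightActionExtending b t B) : A = B := by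
  funext w f
  induction w using weylGroup_induction_simple b with
  | one => rw [hA.one, hB.one]
  | mul w i ih => rw [hA.mul_ofIdx, hB.mul_ofIdx, ih]

end Inversions

lemma algHom_ext_var {σ : Type*} {f g : RatFun σ →ₐ[ℂ] RatFun σ}
    (h : ∀ j, f (var j) = g (var j)) : f = g := by
  apply IsLocalization.algHom_ext (nonZeroDivisors (MvPolynomial σ ℂ))
  apply MvPolynomial.algHom_ext
  intro j
  exact h j

/-! ### Rescaled variables and root monomials -/

section Coordinates

variable {ι M N : Type*} [AddCommGroup M] [Module ℝ M] [AddCommGroup N] [Module ℝ N]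
  {P : RootPairing ι ℝ M N} (b : P.Base) (q : ℕ)

/-- `√q` as a constant rational function. -/
def sqrtConst : RatFun b.support := algebraMap ℂ (RatFun b.support) (Real.sqrt q : ℂ)

/-- The rescaled variable `y_j = √q x_j`. -/
def scaledVar (j : b.support) : RatFun b.support := sqrtConst b q * var j

/-- The rescaled monomial `y^v = √q^{d(v)} x^v`. -/
def scaledMonomial (v : P.rootSpan ℤ) : RatFun b.support :=
  ∏ j : b.support, scaledVar b q j ^ (b.toWeightBasisInt.repr v j : ℤ)

variable {b q}

lemma sqrtConst_sq : sqrtConst b q ^ 2 = (q : RatFun b.support) := by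
  rw [sqrtConst, ← map_pow, ← Complex.ofReal_pow, Real.sq_sqrt (Nat.cast_nonneg q)]
  simp

lemma sqrtConst_ne_zero (hq : q ≠ 0) : sqrtConst b q ≠ 0 := by
  intro h
  have := sqrtConst_sq (b := b) (q := q)
  rw [h] at this
  exact hq (by exact_mod_cast (this.symm.trans (by ring : (0 : RatFun b.support) ^ 2 = 0)))

lemma scaledVar_ne_zero (hq : q ≠ 0) (j : b.support) : scaledVar b q j ≠ 0 :=
  mul_ne_zero (sqrtConst_ne_zero hq) (var_ne_zero j)

lemma scaledMonomial_ne_zero (hq : q ≠ 0) (v : P.rootSpan ℤ) : scaledMonomial b q v ≠ 0 :=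
  Finset.prod_ne_zero_iff.mpr fun j _ ↦ zpow_ne_zero _ (scaledVar_ne_zero hq j)

lemma scaledMonomial_add (hq : q ≠ 0) (v w : P.rootSpan ℤ) :
    scaledMonomial b q (v + w) = scaledMonomial b q v * scaledMonomial b q w := by
  simp only [scaledMonomial, map_add, Finsupp.add_apply, ← Finset.prod_mul_distrib,
    zpow_add₀ (scaledVar_ne_zero hq _)]

lemma scaledMonomial_neg (v : P.rootSpan ℤ) :
    scaledMonomial b q (-v) = (scaledMonomial b q v)⁻¹ := by
  simp only [scaledMonomial, map_neg, Finsupp.neg_apply, zpow_neg, Finset.prod_inv_distrib]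

lemma scaledMonomial_zsmul (n : ℤ) (v : P.rootSpan ℤ) :
    scaledMonomial b q (n • v) = scaledMonomial b q v ^ n := by
  simp only [scaledMonomial, map_zsmul, Finsupp.smul_apply, smul_eq_mul, ← Finset.prod_zpow,
    ← zpow_mul]
  refine Finset.prod_congr rfl fun j _ ↦ ?_
  rw [mul_comm]

lemma toWeightBasisInt_eq (j : b.support) : b.toWeightBasisInt j = P.rootSpanMem ℤ (j : ι) :=
  Subtype.ext (b.coe_toWeightBasisInt_apply j)

lemma scaledMonomial_simple (j : b.support) :
    scaledMonomial b q (P.rootSpanMem ℤ (j : ι)) = scaledVar b q j := by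
  classical
  rw [← toWeightBasisInt_eq, scaledMonomial, Module.Basis.repr_self,
    Finset.prod_eq_single_of_mem j (Finset.mem_univ j)]
  · rw [Finsupp.single_eq_same, zpow_one]
  · intro k _ hk
    rw [Finsupp.single_apply, if_neg (Ne.symm hk), zpow_zero]

lemma algHom_ext_scaledVar (hq : q ≠ 0) {f g : RatFun b.support →ₐ[ℂ] RatFun b.support}
    (h : ∀ j, f (scaledVar b q j) = g (scaledVar b q j)) : f = g := by
  refine algHom_ext_var fun j ↦ mul_left_cancel₀ (sqrtConst_ne_zero hq) ?_
  simpa [scaledVar, sqrtConst] using h j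

lemma sum_repr_rootSpanMem (a : ι) :
    ∑ j, b.toWeightBasisInt.repr (P.rootSpanMem ℤ a) j = b.height a := by
  classical
  let f : ι → ℤ := fun i ↦
    if h : i ∈ b.support then b.toWeightBasisInt.repr (P.rootSpanMem ℤ a) ⟨i, h⟩ else 0
  have h1 : P.root a = ∑ j ∈ b.support, f j • P.root j := by
    have := congrArg (Subtype.val) (b.toWeightBasisInt.sum_repr (P.rootSpanMem ℤ a))
    rw [← b.support.sum_coe_sort]
    simpa [f] using this.symm
  rw [Base.height_eq_sum h1, ← b.support.sum_coe_sort]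
  simp [f]

lemma repr_rootSpanMem_nonneg {a : ι} (ha : b.IsPos a) (j : b.support) :
    0 ≤ b.toWeightBasisInt.repr (P.rootSpanMem ℤ a) j := by
  classical
  let f : ι → ℤ := fun i ↦
    if h : i ∈ b.support then b.toWeightBasisInt.repr (P.rootSpanMem ℤ a) ⟨i, h⟩ else 0
  have h1 : P.root a = ∑ j ∈ b.support, f j • P.root j := by
    have := congrArg (Subtype.val) (b.toWeightBasisInt.sum_repr (P.rootSpanMem ℤ a))
    rw [← b.support.sum_coe_sort]
    simpa [f] using this.symm
  have h2 := b.pos_or_neg_of_sum_smul_root_mem f ⟨a, h1⟩ (by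
    intro i hi
    by_contra h
    exact hi (dif_neg h))
  rcases h2 with h | h
  · simpa [f] using h.le j
  · rw [Base.isPos_iff, Base.height_eq_sum h1] at ha
    exact absurd ha (not_lt.mpr (Finset.sum_nonpos fun i _ ↦ h.le i))

lemma zpow_sum {K : Type*} [Field K] {x : K} (hx : x ≠ 0) {κ : Type*} (s : Finset κ) (f : κ → ℤ) :
    x ^ (∑ j ∈ s, f j) = ∏ j ∈ s, x ^ f j := by
  induction s using Finset.cons_induction with
  | empty => simp
  | cons a s ha ih => rw [Finset.sum_cons, Finset.prod_cons, zpow_add₀ hx, ih]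

/-- The rescaling absorbs the powers of `q`, which turns every factor of `Δ` and `D` into `1 - c
Y_a²` with a constant `c`. -/
lemma scaledMonomial_sq_eq (hq : q ≠ 0) (a : ι) :
    scaledMonomial b q (P.rootSpanMem ℤ a) ^ 2 =
      (q : RatFun b.support) ^ b.height a * monomial b (2 • P.rootSpanMem ℤ a) := by
  rw [← sqrtConst_sq, ← sum_repr_rootSpanMem, monomial, scaledMonomial,
    zpow_sum (pow_ne_zero 2 (sqrtConst_ne_zero hq)), ← Finset.prod_mul_distrib, ← Finset.prod_pow]
  refine Finset.prod_congr rfl fun j _ ↦ ?_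
  rw [scaledVar, mul_zpow, mul_pow, map_nsmul, Finsupp.smul_apply, nsmul_eq_mul]
  simp only [← zpow_natCast, ← zpow_mul, mul_comm]

variable [P.IsCrystallographic]

lemma coroot'In_eq_sum (i : b.support) (v : P.rootSpan ℤ) :
    P.coroot'In ℤ (i : ι) v = ∑ j, b.toWeightBasisInt.repr v j * b.cartanMatrix j i := by
  conv_lhs => rw [← b.toWeightBasisInt.sum_repr v]
  simp only [map_sum, map_zsmul, toWeightBasisInt_eq, coroot'In_rootSpanMem_eq_pairingIn,
    smul_eq_mul]
  rfl

lemma rootSpanMem_reflectionPerm (i a : ι) :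
    P.rootSpanMem ℤ (P.reflectionPerm i a) =
      P.rootSpanMem ℤ a - P.coroot'In ℤ i (P.rootSpanMem ℤ a) • P.rootSpanMem ℤ i := by
  apply Subtype.ext
  rw [coroot'In_rootSpanMem_eq_pairingIn]
  simp only [AddSubgroupClass.coe_sub, SetLike.val_smul]
  rw [root_reflectionPerm, reflection_apply_root' ℤ]

end Coordinates

/-! ### Relations between the substitutions `σ_i` and `ε_i` -/

section Substitutions

variable {ι M N : Type*} [Finite ι] [AddCommGroup M] [Module ℝ M] [AddCommGroup N] [Module ℝ N]
  {P : RootPairing ι ℝ M N} [P.IsCrystallographic] {b : P.Base}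
  (hsl : b.cartanMatrix.IsSimplyLaced) {q : ℕ} (hq : IsPrimePow q)

include hsl

lemma reflectSubst_scaledVar (i j : b.support) :
    reflectSubst b hq i (scaledVar b q j) =
      scaledVar b q j * scaledVar b q i ^ (-b.cartanMatrix j i) := by
  have hs : sqrtConst b q ≠ 0 := sqrtConst_ne_zero hq.ne_zero
  have hx := var_ne_zero i
  have h1 : reflectSubst b hq i (sqrtConst b q) = sqrtConst b q := AlgHom.commutes _ _
  rw [scaledVar, map_mul, h1, reflectSubst, substitute_var, reflectTuple]
  split_ifs with h2 h3
  · rw [h2, b.cartanMatrix_apply_same, ← sqrtConst_sq, scaledVar, zpow_neg, zpow_two]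
    field_simp
  · rw [cartanMatrix_symm hsl h3.1 ((hsl h3.1).resolve_left h3.2), neg_neg, zpow_one, scaledVar]
    change _ * (_ * _ * sqrtConst b q) = _
    ring
  · have : b.cartanMatrix i j = 0 := by
      by_contra hc
      exact h3 ⟨Ne.symm h2, hc⟩
    rw [b.cartanMatrix_apply_eq_zero_iff_symm.mp this]
    simp [scaledVar]

lemma signSubst_scaledVar (i j : b.support) :
    signSubst b i (scaledVar b q j) = (-1) ^ b.cartanMatrix j i * scaledVar b q j := by
  have h1 : signSubst b i (sqrtConst b q) = sqrtConst b q := AlgHom.commutes _ _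
  rw [scaledVar, map_mul, h1, signSubst, substitute_var, signTuple]
  split_ifs with h3
  · rw [cartanMatrix_symm hsl h3.1 ((hsl h3.1).resolve_left h3.2), zpow_neg_one]
    rw [show ((-1 : RatFun b.support))⁻¹ = -1 by norm_num, neg_one_mul, mul_neg]
  · by_cases hij : i = j
    · rw [hij, b.cartanMatrix_apply_same]
      norm_num
    · have : b.cartanMatrix i j = 0 := by
        by_contra hc
        exact h3 ⟨hij, hc⟩
      rw [b.cartanMatrix_apply_eq_zero_iff_symm.mp this]
      simp

lemma reflectSubst_scaledMonomial (i : b.support) (v : P.rootSpan ℤ) :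
    reflectSubst b hq i (scaledMonomial b q v) =
      scaledMonomial b q v * scaledVar b q i ^ (-P.coroot'In ℤ (i : ι) v) := by
  rw [scaledMonomial, map_prod, coroot'In_eq_sum, ← Finset.sum_neg_distrib]
  rw [zpow_sum (scaledVar_ne_zero hq.ne_zero i), ← Finset.prod_mul_distrib]
  refine Finset.prod_congr rfl fun j _ ↦ ?_
  rw [map_zpow₀, reflectSubst_scaledVar hsl, mul_zpow, ← zpow_mul]
  congr 2
  ring

lemma reflectSubst_scaledMonomial_root (i : b.support) (a : ι) :
    reflectSubst b hq i (scaledMonomial b q (P.rootSpanMem ℤ a)) =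
      scaledMonomial b q (P.rootSpanMem ℤ (P.reflectionPerm i a)) := by
  rw [reflectSubst_scaledMonomial hsl, rootSpanMem_reflectionPerm, sub_eq_add_neg,
    scaledMonomial_add hq.ne_zero, ← neg_smul, scaledMonomial_zsmul, scaledMonomial_simple]

lemma signSubst_scaledMonomial (i : b.support) (v : P.rootSpan ℤ) :
    signSubst b i (scaledMonomial b q v) = scaledMonomial b q v ∨
      signSubst b i (scaledMonomial b q v) = - scaledMonomial b q v := by
  rw [scaledMonomial, map_prod]
  induction (Finset.univ : Finset b.support) using Finset.cons_induction with
  | empty => simp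
  | cons a s ha ih =>
    rw [Finset.prod_cons, Finset.prod_cons, map_zpow₀, signSubst_scaledVar hsl, mul_zpow,
      ← zpow_mul]
    rcases Int.even_or_odd (b.cartanMatrix a i * b.toWeightBasisInt.repr v a) with h | h
    · rw [h.neg_one_zpow]
      rcases ih with h | h <;> rw [h] <;> simp
    · rw [h.neg_one_zpow]
      rcases ih with h | h <;> rw [h] <;> simp

/-- Consequently anything built from squares of root monomials, such as `Δ` and `D`, is fixed by all
sign changes. -/
lemma signSubst_scaledMonomial_sq (i : b.support) (v : P.rootSpan ℤ) :
    signSubst b i (scaledMonomial b q v ^ 2) = scaledMonomial b q v ^ 2 := by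
  rw [map_pow]
  rcases signSubst_scaledMonomial hsl i v with h | h <;> rw [h]
  ring

lemma signSubst_comm (i j : b.support) (f : RatFun b.support) :
    signSubst b i (signSubst b j f) = signSubst b j (signSubst b i f) := by
  suffices h : (signSubst b i).comp (signSubst b j) = (signSubst b j).comp (signSubst b i) from
    DFunLike.congr_fun h f
  -- Sign changes do not involve `q`, so any nonzero value serves.
  refine algHom_ext_scaledVar (q := 1) one_ne_zero fun k ↦ ?_
  simp only [AlgHom.comp_apply, signSubst_scaledVar hsl, map_mul, map_zpow₀, map_neg, map_one]
  ring

lemma signSubst_signSubst (i : b.support) (f : RatFun b.support) :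
    signSubst b i (signSubst b i f) = f := by
  suffices h : (signSubst b i).comp (signSubst b i) = AlgHom.id ℂ _ from DFunLike.congr_fun h f
  refine algHom_ext_scaledVar (q := 1) one_ne_zero fun k ↦ ?_
  simp only [AlgHom.comp_apply, signSubst_scaledVar hsl, map_mul, map_zpow₀, map_neg, map_one,
    AlgHom.id_apply, ← mul_assoc, ← mul_zpow]
  simp

lemma reflectSubst_reflectSubst (i : b.support) (f : RatFun b.support) :
    reflectSubst b hq i (reflectSubst b hq i f) = f := by
  suffices h : (reflectSubst b hq i).comp (reflectSubst b hq i) = AlgHom.id ℂ _ from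
    DFunLike.congr_fun h f
  have hy := scaledVar_ne_zero (b := b) hq.ne_zero
  refine algHom_ext_scaledVar hq.ne_zero fun k ↦ ?_
  simp only [AlgHom.comp_apply, reflectSubst_scaledVar hsl, map_mul, map_zpow₀, AlgHom.id_apply,
    b.cartanMatrix_apply_same, mul_assoc, ← mul_zpow]
  have : scaledVar b q i * (scaledVar b q i * scaledVar b q i ^ (-2 : ℤ)) = 1 := by
    have := hy i
    field_simp
  rw [this, one_zpow, mul_one]

lemma signSubst_reflectSubst_self (i : b.support) (f : RatFun b.support) :
    signSubst b i (reflectSubst b hq i f) = reflectSubst b hq i (signSubst b i f) := by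
  suffices h : (signSubst b i).comp (reflectSubst b hq i) =
      (reflectSubst b hq i).comp (signSubst b i) from DFunLike.congr_fun h f
  refine algHom_ext_scaledVar hq.ne_zero fun k ↦ ?_
  simp only [AlgHom.comp_apply, reflectSubst_scaledVar hsl, signSubst_scaledVar hsl, map_mul,
    map_zpow₀, map_neg, map_one, b.cartanMatrix_apply_same]
  norm_num
  ring

section Orthogonal

variable {i j : b.support} (h : b.cartanMatrix i j = 0)

include h

lemma reflectSubst_comm_of_orthogonal (f : RatFun b.support) :
    reflectSubst b hq i (reflectSubst b hq j f) = reflectSubst b hq j (reflectSubst b hq i f) := by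
  have h' := b.cartanMatrix_apply_eq_zero_iff_symm.mp h
  suffices h : (reflectSubst b hq i).comp (reflectSubst b hq j) =
      (reflectSubst b hq j).comp (reflectSubst b hq i) from DFunLike.congr_fun h f
  refine algHom_ext_scaledVar hq.ne_zero fun k ↦ ?_
  simp only [AlgHom.comp_apply, reflectSubst_scaledVar hsl, map_mul, map_zpow₀, h, h', neg_zero,
    zpow_zero, mul_one]
  ring

lemma signSubst_reflectSubst_of_orthogonal (f : RatFun b.support) :
    signSubst b i (reflectSubst b hq j f) = reflectSubst b hq j (signSubst b i f) := by
  have h' := b.cartanMatrix_apply_eq_zero_iff_symm.mp h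
  suffices h : (signSubst b i).comp (reflectSubst b hq j) =
      (reflectSubst b hq j).comp (signSubst b i) from DFunLike.congr_fun h f
  refine algHom_ext_scaledVar hq.ne_zero fun k ↦ ?_
  simp only [AlgHom.comp_apply, reflectSubst_scaledVar hsl, signSubst_scaledVar hsl, map_mul,
    map_zpow₀, map_neg, map_one, h', zpow_zero, one_mul]
  ring

end Orthogonal

section Adjacent

variable {i j : b.support} (h : b.cartanMatrix i j = -1) (h' : b.cartanMatrix j i = -1)

include h h'

lemma reflectSubst_braid (f : RatFun b.support) :
    reflectSubst b hq i (reflectSubst b hq j (reflectSubst b hq i f)) =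
      reflectSubst b hq j (reflectSubst b hq i (reflectSubst b hq j f)) := by
  suffices h : ((reflectSubst b hq i).comp ((reflectSubst b hq j).comp (reflectSubst b hq i))) =
      (reflectSubst b hq j).comp ((reflectSubst b hq i).comp (reflectSubst b hq j)) from
    DFunLike.congr_fun h f
  have hy := scaledVar_ne_zero (b := b) hq.ne_zero
  refine algHom_ext_scaledVar hq.ne_zero fun k ↦ ?_
  simp only [AlgHom.comp_apply, reflectSubst_scaledVar hsl, map_mul, map_zpow₀, h, h', mul_zpow,
    b.cartanMatrix_apply_same, neg_neg, zpow_one]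
  -- Both sides are monomials in `y_k`, `y_i`, `y_j`; the identity below, for `y_i` and for `y_j`,
  -- accounts for their difference.
  have key : ∀ (y : RatFun b.support) (n : ℤ), y ≠ 0 → y ^ n * (y ^ (-2 : ℤ)) ^ n * y ^ n = 1 := by
    intro y n hy
    rw [← mul_zpow, ← mul_zpow]
    have : y * y ^ (-2 : ℤ) * y = 1 := by field_simp
    rw [this, one_zpow]
  have ki := key _ (-b.cartanMatrix k i) (hy i)
  have kj := key _ (-b.cartanMatrix k j) (hy j)
  generalize scaledVar b q i ^ (-b.cartanMatrix k i) = u1 at *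
  generalize scaledVar b q i ^ (-b.cartanMatrix k j) = u2 at *
  generalize scaledVar b q j ^ (-b.cartanMatrix k i) = u3 at *
  generalize scaledVar b q j ^ (-b.cartanMatrix k j) = u4 at *
  linear_combination (scaledVar b q k * u1 * u2 * u3 * u4) * (ki - kj)

omit h in
-- `σ_j` introduces powers of `y_j`, on which `ε_i` acts by `-1`; the resulting extra sign is
-- exactly that of `ε_j`.
lemma signSubst_reflectSubst_of_adjacent (f : RatFun b.support) :
    signSubst b i (reflectSubst b hq j f) =
      reflectSubst b hq j (signSubst b i (signSubst b j f)) := by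
  suffices h : (signSubst b i).comp (reflectSubst b hq j) =
      (reflectSubst b hq j).comp ((signSubst b i).comp (signSubst b j)) from DFunLike.congr_fun h f
  refine algHom_ext_scaledVar hq.ne_zero fun k ↦ ?_
  simp only [AlgHom.comp_apply, reflectSubst_scaledVar hsl, signSubst_scaledVar hsl, map_mul,
    map_zpow₀, map_neg, map_one, h', mul_zpow, ← zpow_mul, neg_one_mul, neg_neg]
  ring

end Adjacent

end Substitutions

/-! ### Scalar identities behind the relations of the twisted operators -/

section Coefficients

variable {K : Type*} [Field K]

/-- The coefficient of `f(σ_i x)` in `f |_ℓ σ_i`, as a function of `y = √q x_i`. -/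
def slashCoeff (s : K) (l : ℕ) (y : K) : K := y ^ l * ((s - 1) * (1 + y) / (2 * y * (s - y)))

/-- The coefficient of `f(ε_i σ_i x)` in `f |_ℓ σ_i`, as a function of `y = √q x_i`. -/
def slashTwistCoeff (s : K) (l : ℕ) (y : K) : K :=
  y ^ l * ((-1) ^ l * (s + 1) * (y - 1) / (2 * y * (s - y)))

variable [CharZero K] {s u v : K} (m n : ℕ)

/-- This is the coefficient of `f` in `f|σ_i|σ_i`; the next lemma treats that of `f(ε_i x)`. -/
lemma slashCoeff_inv (hu : u ≠ 0) (h1 : s - u ≠ 0) (h2 : s * u - 1 ≠ 0) :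
    slashCoeff s m u * slashCoeff s m u⁻¹ + slashTwistCoeff s m u * slashTwistCoeff s m u⁻¹ = 1 := by
  simp only [slashCoeff, slashTwistCoeff, inv_pow]
  have h3 : s - u⁻¹ = (s * u - 1) / u := by field_simp
  rw [h3]
  have h4 : u ^ m ≠ 0 := pow_ne_zero m hu
  rcases neg_one_pow_eq_or K m with he | he <;> rw [he] <;> field_simp <;> ring

lemma slashTwistCoeff_inv (hu : u ≠ 0) (h1 : s - u ≠ 0) (h2 : s * u - 1 ≠ 0) :
    slashCoeff s m u * slashTwistCoeff s m u⁻¹ + slashTwistCoeff s m u * slashCoeff s m u⁻¹ = 0 := by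
  simp only [slashCoeff, slashTwistCoeff, inv_pow]
  have h3 : s - u⁻¹ = (s * u - 1) / u := by field_simp
  rw [h3]
  have h4 : u ^ m ≠ 0 := pow_ne_zero m hu
  rcases neg_one_pow_eq_or K m with he | he <;> rw [he] <;> field_simp <;> ring

variable (hu : u ≠ 0) (hv : v ≠ 0) (h1 : s - u ≠ 0) (h2 : s + u ≠ 0) (h3 : s - v ≠ 0)
  (h4 : s + v ≠ 0) (h5 : s - u * v ≠ 0) (h6 : s + u * v ≠ 0)

include hu hv h1 h2 h3 h4 h5 h6

omit h2 h4 in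
-- For `u = y_i` and `v = y_j`, the four braid identities compare the coefficients of `f`, `ε_i f`,
-- `ε_j f` and `ε_i ε_j f`, each transformed by `σ_j σ_i σ_j`. Negative arguments arise where a sign
-- change has passed over a coefficient.
lemma slashCoeff_braid :
    slashCoeff s m u * slashCoeff s n (u * v) * slashCoeff s m v +
        slashTwistCoeff s m u * slashTwistCoeff s n (-(u * v)) * slashTwistCoeff s m v =
      slashCoeff s n v * slashCoeff s m (u * v) * slashCoeff s n u +
        slashTwistCoeff s n v * slashTwistCoeff s m (-(u * v)) * slashTwistCoeff s n u := by
  simp only [slashCoeff, slashTwistCoeff, mul_pow, neg_pow (u * v), sub_neg_eq_add]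
  rcases neg_one_pow_eq_or K m with he | he <;> rcases neg_one_pow_eq_or K n with hd | hd <;>
    rw [he, hd] <;> field_simp

omit h4 in
lemma slashCoeff_braid_left :
    slashCoeff s m u * slashCoeff s n (u * v) * slashTwistCoeff s m v +
        slashTwistCoeff s m u * slashTwistCoeff s n (-(u * v)) * slashCoeff s m v =
      slashCoeff s n v * slashTwistCoeff s m (u * v) * slashTwistCoeff s n (-u) +
        slashTwistCoeff s n v * slashCoeff s m (-(u * v)) * slashCoeff s n (-u) := by
  simp only [slashCoeff, slashTwistCoeff, mul_pow, neg_pow (u * v), neg_pow u, sub_neg_eq_add]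
  rcases neg_one_pow_eq_or K m with he | he <;> rcases neg_one_pow_eq_or K n with hd | hd <;>
    rw [he, hd] <;> field_simp <;> ring

omit h2 in
lemma slashCoeff_braid_right :
    slashCoeff s m u * slashTwistCoeff s n (u * v) * slashTwistCoeff s m (-v) +
        slashTwistCoeff s m u * slashCoeff s n (-(u * v)) * slashCoeff s m (-v) =
      slashCoeff s n v * slashCoeff s m (u * v) * slashTwistCoeff s n u +
        slashTwistCoeff s n v * slashTwistCoeff s m (-(u * v)) * slashCoeff s n u := by
  simp only [slashCoeff, slashTwistCoeff, mul_pow, neg_pow (u * v), neg_pow v, sub_neg_eq_add]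
  rcases neg_one_pow_eq_or K m with he | he <;> rcases neg_one_pow_eq_or K n with hd | hd <;>
    rw [he, hd] <;> field_simp <;> ring

lemma slashCoeff_braid_both :
    slashCoeff s m u * slashTwistCoeff s n (u * v) * slashCoeff s m (-v) +
        slashTwistCoeff s m u * slashCoeff s n (-(u * v)) * slashTwistCoeff s m (-v) =
      slashCoeff s n v * slashTwistCoeff s m (u * v) * slashCoeff s n (-u) +
        slashTwistCoeff s n v * slashCoeff s m (-(u * v)) * slashTwistCoeff s n (-u) := by
  simp only [slashCoeff, slashTwistCoeff, mul_pow, neg_pow (u * v), neg_pow u, neg_pow v,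
    sub_neg_eq_add]
  rcases neg_one_pow_eq_or K m with he | he <;> rcases neg_one_pow_eq_or K n with hd | hd <;>
    rw [he, hd] <;> field_simp <;> ring

end Coefficients

/-! ### The twisted operators satisfy the Coxeter relations -/

section Slash

variable {ι M N : Type*} {σ : Type*}

lemma algebraMap_ne_zero_of_constantCoeff {p : MvPolynomial σ ℂ}
    (h : MvPolynomial.constantCoeff p ≠ 0) :
    algebraMap (MvPolynomial σ ℂ) (RatFun σ) p ≠ 0 := by
  rw [ne_eq, FaithfulSMul.algebraMap_eq_zero_iff]
  rintro rfl
  exact h (map_zero _)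

lemma algebraMap_C (c : ℂ) :
    algebraMap (MvPolynomial σ ℂ) (RatFun σ) (MvPolynomial.C c) = algebraMap ℂ (RatFun σ) c := by
  rw [← MvPolynomial.algebraMap_eq, ← IsScalarTower.algebraMap_apply]

variable [Finite ι] [AddCommGroup M] [Module ℝ M] [AddCommGroup N] [Module ℝ N]
  {P : RootPairing ι ℝ M N} [P.IsCrystallographic] {b : P.Base} {q : ℕ}

omit [Finite ι] [P.IsCrystallographic] in
lemma sqrt_ne_zero (hq : q ≠ 0) : (Real.sqrt q : ℂ) ≠ 0 := by
  rw [ne_eq, Complex.ofReal_eq_zero, Real.sqrt_eq_zero', not_le]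
  exact_mod_cast Nat.pos_of_ne_zero hq

omit [Finite ι] [P.IsCrystallographic] in
lemma algebraMap_C_mul_X (j : b.support) :
    algebraMap (MvPolynomial b.support ℂ) (RatFun b.support)
      (MvPolynomial.C (Real.sqrt q : ℂ) * MvPolynomial.X j) = scaledVar b q j := by
  rw [map_mul, algebraMap_C]
  rfl

omit [Finite ι] [P.IsCrystallographic] in
lemma sqrtConst_add_mul_scaledVar_ne_zero (hq : q ≠ 0) (c : ℂ) (i : b.support) :
    sqrtConst b q + algebraMap ℂ _ c * scaledVar b q i ≠ 0 := by
  have : sqrtConst b q + algebraMap ℂ _ c * scaledVar b q i =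
      algebraMap (MvPolynomial b.support ℂ) (RatFun b.support)
        (MvPolynomial.C (Real.sqrt q : ℂ) +
          MvPolynomial.C c * (MvPolynomial.C (Real.sqrt q : ℂ) * MvPolynomial.X i)) := by
    rw [map_add, map_mul, algebraMap_C_mul_X, algebraMap_C, algebraMap_C, sqrtConst]
  rw [this]
  apply algebraMap_ne_zero_of_constantCoeff
  simpa using hq

omit [Finite ι] [P.IsCrystallographic] in
lemma sqrtConst_sub_scaledVar_ne_zero (hq : q ≠ 0) (i : b.support) :
    sqrtConst b q - scaledVar b q i ≠ 0 := by
  simpa [sub_eq_add_neg] using sqrtConst_add_mul_scaledVar_ne_zero hq (-1) i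

omit [Finite ι] [P.IsCrystallographic] in
lemma sqrtConst_add_scaledVar_ne_zero (hq : q ≠ 0) (i : b.support) :
    sqrtConst b q + scaledVar b q i ≠ 0 := by
  simpa using sqrtConst_add_mul_scaledVar_ne_zero hq 1 i

omit [Finite ι] [P.IsCrystallographic] in
lemma sqrtConst_mul_scaledVar_sub_one_ne_zero (i : b.support) :
    sqrtConst b q * scaledVar b q i - 1 ≠ 0 := by
  have : sqrtConst b q * scaledVar b q i - 1 =
      algebraMap (MvPolynomial b.support ℂ) (RatFun b.support)
        (MvPolynomial.C (Real.sqrt q : ℂ) *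
          (MvPolynomial.C (Real.sqrt q : ℂ) * MvPolynomial.X i) - 1) := by
    rw [map_sub, map_mul, algebraMap_C_mul_X, algebraMap_C, sqrtConst, map_one]
  rw [this]
  apply algebraMap_ne_zero_of_constantCoeff
  simp

omit [Finite ι] [P.IsCrystallographic] in
lemma sqrtConst_add_mul_scaledVar_mul_ne_zero (hq : q ≠ 0) (c : ℂ) (i j : b.support) :
    sqrtConst b q + algebraMap ℂ _ c * (scaledVar b q i * scaledVar b q j) ≠ 0 := by
  have : sqrtConst b q + algebraMap ℂ _ c * (scaledVar b q i * scaledVar b q j) =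
      algebraMap (MvPolynomial b.support ℂ) (RatFun b.support)
        (MvPolynomial.C (Real.sqrt q : ℂ) +
          MvPolynomial.C c * ((MvPolynomial.C (Real.sqrt q : ℂ) * MvPolynomial.X i) *
            (MvPolynomial.C (Real.sqrt q : ℂ) * MvPolynomial.X j))) := by
    rw [map_add, map_mul, map_mul, algebraMap_C_mul_X, algebraMap_C_mul_X, algebraMap_C,
      algebraMap_C, sqrtConst]
  rw [this]
  apply algebraMap_ne_zero_of_constantCoeff
  simpa using hq

omit [Finite ι] [P.IsCrystallographic] in
lemma map_slashCoeff (g : RatFun b.support →ₐ[ℂ] RatFun b.support) (l : ℕ)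
    (y : RatFun b.support) :
    g (slashCoeff (sqrtConst b q) l y) = slashCoeff (sqrtConst b q) l (g y) := by
  have : g (sqrtConst b q) = sqrtConst b q := AlgHom.commutes _ _
  simp [slashCoeff, this, map_ofNat g 2]

omit [Finite ι] [P.IsCrystallographic] in
lemma map_slashTwistCoeff (g : RatFun b.support →ₐ[ℂ] RatFun b.support) (l : ℕ)
    (y : RatFun b.support) :
    g (slashTwistCoeff (sqrtConst b q) l y) = slashTwistCoeff (sqrtConst b q) l (g y) := by
  have : g (sqrtConst b q) = sqrtConst b q := AlgHom.commutes _ _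
  simp [slashTwistCoeff, this, map_ofNat g 2]

variable (hsl : b.cartanMatrix.IsSimplyLaced) (hq : IsPrimePow q) (l : b.support → ℕ)

lemma simpleSlash_eq (i : b.support) (f : RatFun b.support) :
    simpleSlash b hq l i f =
      slashCoeff (sqrtConst b q) (l i) (scaledVar b q i) * reflectSubst b hq i f +
        slashTwistCoeff (sqrtConst b q) (l i) (scaledVar b q i) *
          reflectSubst b hq i (signSubst b i f) := by
  have h1 := sqrtConst_sub_scaledVar_ne_zero (b := b) hq.ne_zero i
  have hx := var_ne_zero i
  have hs := sqrtConst_ne_zero (b := b) hq.ne_zero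
  have h2 : (1 : RatFun b.support) - var i ≠ 0 := by
    intro h
    apply h1
    rw [scaledVar]
    linear_combination sqrtConst b q * h
  simp only [simpleSlash, plusPart, minusPart, map_div₀, map_add, map_sub, map_mul, map_pow,
    map_neg, map_one, map_ofNat, slashCoeff, slashTwistCoeff]
  rw [← sqrtConst_sq (b := b)]
  change _ * (var i * sqrtConst b q) ^ l i * _ +
    1 / (var i * sqrtConst b q) * (var i * sqrtConst b q) ^ l i * _ = _
  rw [scaledVar] at *
  have h3 : sqrtConst b q - sqrtConst b q * var i = sqrtConst b q * (1 - var i) := by ring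
  rw [h3, mul_comm (var i)]
  generalize (sqrtConst b q * var i) ^ l i = u
  field_simp
  ring

lemma simpleSlash_add (i : b.support) (f g : RatFun b.support) :
    simpleSlash b hq l i (f + g) = simpleSlash b hq l i f + simpleSlash b hq l i g := by
  simp only [simpleSlash_eq, map_add]
  ring

/-- An `ε_i`-invariant factor does not disturb the even and odd parts; this moves `1/Δ(wx)` through
the operator. -/
lemma simpleSlash_mul_of_signSubst_eq {i : b.support} {g : RatFun b.support}
    (hg : signSubst b i g = g) (f : RatFun b.support) :
    simpleSlash b hq l i (g * f) = reflectSubst b hq i g * simpleSlash b hq l i f := by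
  simp only [simpleSlash_eq, map_mul, hg]
  ring

include hsl

lemma reflectSubst_scaledVar_self (i : b.support) :
    reflectSubst b hq i (scaledVar b q i) = (scaledVar b q i)⁻¹ := by
  have := scaledVar_ne_zero (b := b) hq.ne_zero i
  rw [reflectSubst_scaledVar hsl, b.cartanMatrix_apply_same]
  field_simp

lemma signSubst_scaledVar_self (i : b.support) :
    signSubst b i (scaledVar b q i) = scaledVar b q i := by
  rw [signSubst_scaledVar hsl, b.cartanMatrix_apply_same]
  norm_num

lemma simpleSlash_simpleSlash (i : b.support) (f : RatFun b.support) :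
    simpleSlash b hq l i (simpleSlash b hq l i f) = f := by
  have hu := scaledVar_ne_zero (b := b) hq.ne_zero i
  have h1 := sqrtConst_sub_scaledVar_ne_zero (b := b) hq.ne_zero i
  have h2 := sqrtConst_mul_scaledVar_sub_one_ne_zero (b := b) (q := q) i
  simp only [simpleSlash_eq, map_add, map_mul, map_slashCoeff, map_slashTwistCoeff,
    reflectSubst_scaledVar_self hsl, signSubst_scaledVar_self hsl,
    signSubst_reflectSubst_self hsl, reflectSubst_reflectSubst hsl, signSubst_signSubst hsl]
  linear_combination f * slashCoeff_inv (l i) hu h1 h2 +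
    signSubst b i f * slashTwistCoeff_inv (l i) hu h1 h2

lemma simpleSlash_comm {i j : b.support} (h : b.cartanMatrix i j = 0) (f : RatFun b.support) :
    simpleSlash b hq l i (simpleSlash b hq l j f) =
      simpleSlash b hq l j (simpleSlash b hq l i f) := by
  have h' := b.cartanMatrix_apply_eq_zero_iff_symm.mp h
  simp only [simpleSlash_eq, map_add, map_mul, map_slashCoeff, map_slashTwistCoeff,
    reflectSubst_scaledVar hsl, signSubst_scaledVar hsl, h, h', neg_zero, zpow_zero, mul_one,
    one_mul, signSubst_reflectSubst_of_orthogonal hsl hq h,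
    signSubst_reflectSubst_of_orthogonal hsl hq h', signSubst_comm hsl i j,
    reflectSubst_comm_of_orthogonal hsl hq h]
  ring

lemma simpleSlash_braid {i j : b.support} (h : b.cartanMatrix i j = -1)
    (h' : b.cartanMatrix j i = -1) (f : RatFun b.support) :
    simpleSlash b hq l i (simpleSlash b hq l j (simpleSlash b hq l i f)) =
      simpleSlash b hq l j (simpleSlash b hq l i (simpleSlash b hq l j f)) := by
  have hu := scaledVar_ne_zero (b := b) hq.ne_zero i
  have hv := scaledVar_ne_zero (b := b) hq.ne_zero j
  have h1 := sqrtConst_sub_scaledVar_ne_zero (b := b) hq.ne_zero i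
  have h2 := sqrtConst_add_scaledVar_ne_zero (b := b) hq.ne_zero i
  have h3 := sqrtConst_sub_scaledVar_ne_zero (b := b) hq.ne_zero j
  have h4 := sqrtConst_add_scaledVar_ne_zero (b := b) hq.ne_zero j
  have h5 : sqrtConst b q - scaledVar b q i * scaledVar b q j ≠ 0 := by
    simpa [sub_eq_add_neg] using sqrtConst_add_mul_scaledVar_mul_ne_zero hq.ne_zero (-1) i j
  have h6 : sqrtConst b q + scaledVar b q i * scaledVar b q j ≠ 0 := by
    simpa using sqrtConst_add_mul_scaledVar_mul_ne_zero hq.ne_zero 1 i j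
  have r1 : reflectSubst b hq i (scaledVar b q j) = scaledVar b q i * scaledVar b q j := by
    rw [reflectSubst_scaledVar hsl, h', neg_neg, zpow_one, mul_comm]
  have r2 : reflectSubst b hq j (scaledVar b q i) = scaledVar b q i * scaledVar b q j := by
    rw [reflectSubst_scaledVar hsl, h, neg_neg, zpow_one]
  have e1 : signSubst b i (scaledVar b q j) = -scaledVar b q j := by
    rw [signSubst_scaledVar hsl, h', zpow_neg_one]
    norm_num
  have e2 : signSubst b j (scaledVar b q i) = -scaledVar b q i := by
    rw [signSubst_scaledVar hsl, h, zpow_neg_one]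
    norm_num
  have c1 : (scaledVar b q i)⁻¹ * (scaledVar b q i * scaledVar b q j) = scaledVar b q j := by
    field_simp
  have c2 : scaledVar b q i * scaledVar b q j * (scaledVar b q j)⁻¹ = scaledVar b q i := by
    field_simp
  simp only [simpleSlash_eq, map_add, map_mul, map_neg, map_slashCoeff, map_slashTwistCoeff,
    r1, r2, e1, e2, reflectSubst_scaledVar_self hsl, signSubst_scaledVar_self hsl, mul_neg, neg_mul, neg_neg,
    c1, c2, signSubst_reflectSubst_self hsl, signSubst_reflectSubst_of_adjacent hsl hq h',
    signSubst_reflectSubst_of_adjacent hsl hq h, signSubst_signSubst hsl,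
    signSubst_comm hsl j i, reflectSubst_braid hsl hq h h']
  set F := fun g ↦ reflectSubst b hq j (reflectSubst b hq i (reflectSubst b hq j g))
  linear_combination F f * slashCoeff_braid (l i) (l j) hu hv h1 h3 h5 h6 +
    F (signSubst b i f) * slashCoeff_braid_left (l i) (l j) hu hv h1 h2 h3 h5 h6 +
    F (signSubst b j f) * slashCoeff_braid_right (l i) (l j) hu hv h1 h3 h4 h5 h6 +
    F (signSubst b i (signSubst b j f)) *
      slashCoeff_braid_both (l i) (l j) hu hv h1 h2 h3 h4 h5 h6

end Slash

/-! ### `Δ` and `D` as products over positive roots -/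

section Products

variable {ι M N : Type*} [AddCommGroup M] [Module ℝ M] [AddCommGroup N] [Module ℝ N]
  {P : RootPairing ι ℝ M N} (b : P.Base) (q : ℕ)

/-- The rescaled monomial attached to a root. -/
def rootMonomial (a : ι) : RatFun b.support := scaledMonomial b q (P.rootSpanMem ℤ a)

/-- The polynomial representing `rootMonomial b q a` when `a` is positive. -/
def rootPolynomial (a : ι) : MvPolynomial b.support ℂ :=
  ∏ j : b.support, (MvPolynomial.C (Real.sqrt q : ℂ) * MvPolynomial.X j) ^
    (b.toWeightBasisInt.repr (P.rootSpanMem ℤ a) j).toNat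

open Classical in
/-- The finite set of positive roots. -/
def posRoots [Fintype ι] : Finset ι := {a | b.IsPos a}

/-- The subalgebra of polynomials in the field of rational functions. -/
def polynomials (σ : Type*) : Subalgebra ℂ (RatFun σ) :=
  (IsScalarTower.toAlgHom ℂ (MvPolynomial σ ℂ) (RatFun σ)).range

variable {b q}

lemma mem_polynomials {σ : Type*} {f : RatFun σ} :
    f ∈ polynomials σ ↔ ∃ p, algebraMap (MvPolynomial σ ℂ) (RatFun σ) p = f := Iff.rfl

lemma algebraMap_mem_polynomials {σ : Type*} (p : MvPolynomial σ ℂ) :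
    algebraMap (MvPolynomial σ ℂ) (RatFun σ) p ∈ polynomials σ := ⟨p, rfl⟩

lemma mem_posRoots [Fintype ι] {a : ι} : a ∈ posRoots b ↔ b.IsPos a := by
  classical
  simp only [posRoots, Finset.mem_filter, Finset.mem_univ, true_and]

lemma rootMonomial_simple (i : b.support) : rootMonomial b q (i : ι) = scaledVar b q i :=
  scaledMonomial_simple i

lemma rootMonomial_ne_zero (hq : q ≠ 0) (a : ι) : rootMonomial b q a ≠ 0 :=
  scaledMonomial_ne_zero hq _

lemma algebraMap_rootPolynomial {a : ι} (ha : b.IsPos a) :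
    algebraMap _ (RatFun b.support) (rootPolynomial b q a) = rootMonomial b q a := by
  rw [rootPolynomial, map_prod, rootMonomial, scaledMonomial]
  refine Finset.prod_congr rfl fun j _ ↦ ?_
  rw [map_pow, algebraMap_C_mul_X, ← zpow_natCast, Int.toNat_of_nonneg (repr_rootSpanMem_nonneg ha j)]

lemma exists_repr_pos {a : ι} (ha : b.IsPos a) :
    ∃ j, 0 < b.toWeightBasisInt.repr (P.rootSpanMem ℤ a) j := by
  by_contra! h
  rw [Base.isPos_iff, ← sum_repr_rootSpanMem] at ha
  exact absurd ha (not_lt.mpr (Finset.sum_nonpos fun j _ ↦ h j))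

lemma constantCoeff_rootPolynomial {a : ι} (ha : b.IsPos a) :
    MvPolynomial.constantCoeff (rootPolynomial b q a) = 0 := by
  obtain ⟨j, hj⟩ := exists_repr_pos ha
  rw [rootPolynomial, map_prod]
  refine Finset.prod_eq_zero (Finset.mem_univ j) ?_
  rw [map_pow, map_mul, MvPolynomial.constantCoeff_X, mul_zero, zero_pow]
  omega

lemma rootMonomial_mem_polynomials {a : ι} (ha : b.IsPos a) :
    rootMonomial b q a ∈ polynomials b.support :=
  ⟨_, algebraMap_rootPolynomial ha⟩

variable (b q) in
/-- The factor `1 - c q^{d(a)} x^{2a}`. -/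
def rootFactor (c : ℂ) (a : ι) : RatFun b.support :=
  1 - algebraMap ℂ _ c * rootMonomial b q a ^ 2

lemma algebraMap_one_sub_rootPolynomial (c : ℂ) {a : ι} (ha : b.IsPos a) :
    algebraMap _ (RatFun b.support) (1 - MvPolynomial.C c * rootPolynomial b q a ^ 2) =
      rootFactor b q c a := by
  rw [map_sub, map_one, map_mul, map_pow, algebraMap_rootPolynomial ha, algebraMap_C, rootFactor]

lemma rootFactor_mem_polynomials (c : ℂ) {a : ι} (ha : b.IsPos a) :
    rootFactor b q c a ∈ polynomials b.support :=
  ⟨_, algebraMap_one_sub_rootPolynomial c ha⟩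

lemma rootFactor_ne_zero (c : ℂ) {a : ι} (ha : b.IsPos a) : rootFactor b q c a ≠ 0 := by
  rw [← algebraMap_one_sub_rootPolynomial c ha]
  apply algebraMap_ne_zero_of_constantCoeff
  simp [constantCoeff_rootPolynomial ha]

variable [Fintype ι]

lemma Delta_eq (hq : q ≠ 0) : Delta b q = ∏ a ∈ posRoots b, rootFactor b q 1 a := by
  classical
  refine Finset.prod_congr (by ext a; simp [mem_posRoots]) fun a _ ↦ ?_
  rw [rootFactor, rootMonomial, scaledMonomial_sq_eq hq, map_one, one_mul]

lemma denom_eq (hq : q ≠ 0) : denom b q = ∏ a ∈ posRoots b, rootFactor b q (q : ℂ)⁻¹ a := by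
  classical
  refine Finset.prod_congr (by ext a; simp [mem_posRoots]) fun a _ ↦ ?_
  have hq' : (q : RatFun b.support) ≠ 0 := Nat.cast_ne_zero.mpr hq
  rw [rootFactor, rootMonomial, scaledMonomial_sq_eq hq, map_inv₀, map_natCast, zpow_sub_one₀ hq']
  ring

lemma prod_rootFactor_ne_zero (c : ℂ) {s : Finset ι} (hs : s ⊆ posRoots b) :
    ∏ a ∈ s, rootFactor b q c a ≠ 0 :=
  Finset.prod_ne_zero_iff.mpr fun _ ha ↦ rootFactor_ne_zero c (mem_posRoots.mp (hs ha))

lemma Delta_ne_zero (hq : q ≠ 0) : Delta b q ≠ 0 := by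
  rw [Delta_eq hq]
  exact prod_rootFactor_ne_zero 1 subset_rfl

lemma denom_ne_zero (hq : q ≠ 0) : denom b q ≠ 0 := by
  rw [denom_eq hq]
  exact prod_rootFactor_ne_zero _ subset_rfl

variable [P.IsCrystallographic] (hsl : b.cartanMatrix.IsSimplyLaced) (hq : IsPrimePow q)

include hsl

omit [Fintype ι] in
lemma signSubst_rootFactor [Finite ι] (i : b.support) (c : ℂ) (a : ι) :
    signSubst b i (rootFactor b q c a) = rootFactor b q c a := by
  rw [rootFactor, map_sub, map_one, map_mul, rootMonomial, signSubst_scaledMonomial_sq hsl,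
    AlgHom.commutes]

omit [Fintype ι] in
lemma reflectSubst_rootMonomial [Finite ι] (i : b.support) (a : ι) :
    reflectSubst b hq i (rootMonomial b q a) = rootMonomial b q (P.reflectionPerm i a) :=
  reflectSubst_scaledMonomial_root hsl hq i a

omit [Fintype ι] in
lemma reflectSubst_rootFactor [Finite ι] (i : b.support) (c : ℂ) (a : ι) :
    reflectSubst b hq i (rootFactor b q c a) = rootFactor b q c (P.reflectionPerm i a) := by
  rw [rootFactor, map_sub, map_one, map_mul, map_pow, reflectSubst_rootMonomial hsl,
    AlgHom.commutes, rootFactor]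

open Classical in
lemma reflectSubst_prod_erase [P.IsReduced] (i : b.support) (c : ℂ) :
    reflectSubst b hq i (∏ a ∈ (posRoots b).erase (i : ι), rootFactor b q c a) =
      ∏ a ∈ (posRoots b).erase (i : ι), rootFactor b q c a := by
  rw [map_prod]
  have hmem : ∀ a ∈ (posRoots b).erase (i : ι),
      P.reflectionPerm i a ∈ (posRoots b).erase (i : ι) := by
    intro a ha
    rw [Finset.mem_erase, mem_posRoots] at ha ⊢
    refine ⟨fun hc ↦ not_isPos_reflectionPerm_self (b := b) i.2 ?_, ha.2.reflectionPerm i.2 ha.1⟩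
    rw [← P.reflectionPerm_self i a, hc] at ha
    exact ha.2
  refine Finset.prod_nbij' (P.reflectionPerm i) (P.reflectionPerm i) hmem hmem ?_ ?_ ?_
  · exact fun a _ ↦ P.reflectionPerm_self i a
  · exact fun a _ ↦ P.reflectionPerm_self i a
  · exact fun a _ ↦ reflectSubst_rootFactor hsl hq i c a

omit [P.IsCrystallographic] hsl in
open Classical in
lemma prod_posRoots_eq (i : b.support) (c : ℂ) :
    ∏ a ∈ posRoots b, rootFactor b q c a =
      (1 - algebraMap ℂ _ c * scaledVar b q i ^ 2) *
        ∏ a ∈ (posRoots b).erase (i : ι), rootFactor b q c a := by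
  rw [← Finset.mul_prod_erase _ _ (mem_posRoots.mpr (Base.isPos_of_mem_support i.2)), rootFactor,
    rootMonomial_simple]

/-- Only the factor at `α_i` changes, because `s_i` permutes the remaining positive roots. -/
lemma reflectSubst_prod_posRoots [P.IsReduced] (i : b.support) (c : ℂ) :
    reflectSubst b hq i (∏ a ∈ posRoots b, rootFactor b q c a) *
        (1 - algebraMap ℂ _ c * scaledVar b q i ^ 2) =
      (1 - algebraMap ℂ _ c * (scaledVar b q i ^ 2)⁻¹) * ∏ a ∈ posRoots b, rootFactor b q c a := by
  classical
  rw [prod_posRoots_eq i, map_mul, reflectSubst_prod_erase hsl, map_sub, map_mul, map_pow,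
    reflectSubst_scaledVar_self hsl, AlgHom.commutes, map_one]
  ring

lemma signSubst_prod_posRoots (i : b.support) (c : ℂ) :
    signSubst b i (∏ a ∈ posRoots b, rootFactor b q c a) =
      ∏ a ∈ posRoots b, rootFactor b q c a := by
  rw [map_prod]
  exact Finset.prod_congr rfl fun a _ ↦ signSubst_rootFactor hsl i c a

/-- For `c = 1` the ratio of the two factors at `α_i` is a monomial: `1 - y⁻² = -y⁻² (1 - y²)`. -/
lemma reflectSubst_Delta [P.IsReduced] (i : b.support) :
    reflectSubst b hq i (Delta b q) * scaledVar b q i ^ 2 = - Delta b q := by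
  have h0 := rootFactor_ne_zero (q := q) (1 : ℂ) (Base.isPos_of_mem_support i.2)
  rw [rootFactor, map_one, one_mul, rootMonomial_simple] at h0
  have hy := scaledVar_ne_zero (b := b) hq.ne_zero i
  have := reflectSubst_prod_posRoots hsl hq i (1 : ℂ)
  rw [← Delta_eq hq.ne_zero, map_one, one_mul, one_mul] at this
  apply mul_right_cancel₀ h0
  field_simp at this
  linear_combination this

end Products

/-! ### The average: polynomiality of `D Δ f` and invariance -/

section Slash

variable {ι M N : Type*} [Fintype ι] [AddCommGroup M] [Module ℝ M] [AddCommGroup N] [Module ℝ N]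
  {P : RootPairing ι ℝ M N} [P.IsCrystallographic] [P.IsReduced] [P.IsRootSystem] {b : P.Base}
  (hsl : b.cartanMatrix.IsSimplyLaced) {q : ℕ} (hq : IsPrimePow q) (l : b.support → ℕ)
  {S A : P.weylGroup → RatFun b.support → RatFun b.support}

include hsl

omit hsl [P.IsCrystallographic] [P.IsReduced] [P.IsRootSystem] in
lemma inversions_one : inversions b (1 : P.weylGroup) = ∅ := by
  ext a
  simp [mem_inversions]

omit [P.IsReduced] [P.IsRootSystem] in
-- `ε_i` passes over the product used in `slash_one_mem` at the cost of a sign, which does not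
-- affect membership in an algebra.
lemma signSubst_prod_rootMonomial_mul (i : b.support) (c : ℂ) (s : Finset ι) :
    signSubst b i (∏ a ∈ s, rootMonomial b q a * rootFactor b q c a) =
        ∏ a ∈ s, rootMonomial b q a * rootFactor b q c a ∨
      signSubst b i (∏ a ∈ s, rootMonomial b q a * rootFactor b q c a) =
        -∏ a ∈ s, rootMonomial b q a * rootFactor b q c a := by
  induction s using Finset.cons_induction with
  | empty => simp
  | cons a s ha ih =>
    rw [Finset.prod_cons, map_mul, map_mul, signSubst_rootFactor hsl]
    rcases signSubst_scaledMonomial hsl (q := q) i (P.rootSpanMem ℤ a) with h | h <;>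
      rcases ih with h' | h' <;> rw [rootMonomial, h, h'] <;> simp

/-- This evaluates `j(w, x)`. Each length-increasing step contributes `-y_i²` by
`reflectSubst_Delta`, and the earlier inversions are reflected by `s_i`. -/
lemma Delta_eq_neg_one_pow_mul (hS : IsRightActionExtending b (fun i f ↦ reflectSubst b hq i f) S)
    (w : P.weylGroup) : ∃ n : ℕ, Delta b q =
      (-1) ^ n * (∏ a ∈ inversions b w, rootMonomial b q a ^ 2) * S w (Delta b q) := by
  classical
  induction w using weylGroup_induction_ascent hsl with
  | one =>
    refine ⟨0, ?_⟩
    rw [inversions_one, Finset.prod_empty, hS.one]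
    ring
  | mul w i hi ih =>
    obtain ⟨n, hn⟩ := ih
    refine ⟨n + 1, ?_⟩
    have h1 := congrArg (reflectSubst b hq i) hn
    have h2 := reflectSubst_Delta hsl hq i
    rw [inversions_mul_ofIdx i.2 hi, Finset.prod_insert (notMem_map_inversions i.2),
      Finset.prod_map, hS.mul_ofIdx, rootMonomial_simple]
    simp only [map_mul, map_pow, map_neg, map_one, map_prod,
      reflectSubst_rootMonomial hsl] at h1
    simp only [Equiv.coe_toEmbedding]
    rw [h1] at h2
    linear_combination h2

/-- Polynomials are not preserved by `σ_i`, but the algebra generated by the `Y_a` of the inversions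
of `w` is carried into the one for `w s_i`; hence this sharper form for the induction. The new
factor `y_i (1 - y_i²/q)` cancels the denominator `2 y_i (√q - y_i)` of both coefficients. -/
lemma slash_one_mem (hA : IsRightActionExtending b (simpleSlash b hq l) A) (w : P.weylGroup) :
    (∏ a ∈ inversions b w, rootMonomial b q a * rootFactor b q (q : ℂ)⁻¹ a) * A w 1 ∈
      Algebra.adjoin ℂ (rootMonomial b q '' (inversions b w)) := by
  classical
  induction w using weylGroup_induction_ascent hsl with
  | one =>
    rw [inversions_one, Finset.prod_empty, hA.one, one_mul]
    exact one_mem _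
  | mul w i hi ih =>
    set B := Algebra.adjoin ℂ (rootMonomial b q '' (inversions b w)) with hB
    set B' := Algebra.adjoin ℂ (rootMonomial b q '' (inversions b (w * weylGroup.ofIdx P (i : ι))))
      with hB'
    have hI := inversions_mul_ofIdx i.2 hi
    have hgen : ∀ a ∈ inversions b (w * weylGroup.ofIdx P (i : ι)), rootMonomial b q a ∈ B' :=
      fun a ha ↦ Algebra.subset_adjoin ⟨a, ha, rfl⟩
    have hy : scaledVar b q i ∈ B' := by
      rw [← rootMonomial_simple]
      refine hgen _ ?_
      rw [hI]
      exact Finset.mem_insert_self _ _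
    have hR : ∀ g ∈ B, reflectSubst b hq i g ∈ B' := by
      intro g hg
      suffices h : B ≤ B'.comap (reflectSubst b hq i) from h hg
      refine Algebra.adjoin_le ?_
      rintro _ ⟨a, ha, rfl⟩
      rw [SetLike.mem_coe, Subalgebra.mem_comap, reflectSubst_rootMonomial hsl]
      refine hgen _ ?_
      rw [hI]
      exact Finset.mem_insert_of_mem (Finset.mem_map_of_mem _ ha)
    have hE : ∀ g ∈ B, signSubst b i g ∈ B := by
      intro g hg
      suffices h : B ≤ B.comap (signSubst b i) from h hg
      refine Algebra.adjoin_le ?_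
      rintro _ ⟨a, ha, rfl⟩
      have : rootMonomial b q a ∈ B := Algebra.subset_adjoin ⟨a, ha, rfl⟩
      rw [SetLike.mem_coe, Subalgebra.mem_comap]
      rcases signSubst_scaledMonomial hsl (q := q) i (P.rootSpanMem ℤ a) with h | h
      · rw [rootMonomial, h]
        exact this
      · rw [rootMonomial, h]
        exact neg_mem this
    have hs : sqrtConst b q ∈ B' := Subalgebra.algebraMap_mem _ _
    have hs0 := sqrtConst_ne_zero (b := b) hq.ne_zero
    have hy0 := scaledVar_ne_zero (b := b) hq.ne_zero i
    have hsy := sqrtConst_sub_scaledVar_ne_zero (b := b) hq.ne_zero i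
    have hF : rootFactor b q (q : ℂ)⁻¹ (i : ι) =
        (sqrtConst b q - scaledVar b q i) * (sqrtConst b q + scaledVar b q i) /
          sqrtConst b q ^ 2 := by
      rw [rootFactor, rootMonomial_simple, map_inv₀, map_natCast, ← sqrtConst_sq (b := b)]
      field_simp
      ring
    have hc : algebraMap ℂ (RatFun b.support) (2 * (q : ℂ))⁻¹ = (2 * sqrtConst b q ^ 2)⁻¹ := by
      rw [map_inv₀, map_mul, map_natCast, map_ofNat, sqrtConst_sq]
    have hcm : (2 * sqrtConst b q ^ 2)⁻¹ ∈ B' := hc ▸ Subalgebra.algebraMap_mem _ _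
    have h1 : scaledVar b q i * rootFactor b q (q : ℂ)⁻¹ (i : ι) *
        slashCoeff (sqrtConst b q) (l i) (scaledVar b q i) ∈ B' := by
      have : scaledVar b q i * rootFactor b q (q : ℂ)⁻¹ (i : ι) *
          slashCoeff (sqrtConst b q) (l i) (scaledVar b q i) =
          scaledVar b q i ^ l i * ((sqrtConst b q - 1) * (1 + scaledVar b q i) *
            (sqrtConst b q + scaledVar b q i)) * (2 * sqrtConst b q ^ 2)⁻¹ := by
        rw [hF, slashCoeff]
        field_simp
      rw [this]
      exact mul_mem (mul_mem (pow_mem hy _) (mul_mem (mul_mem (sub_mem hs (one_mem _))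
        (add_mem (one_mem _) hy)) (add_mem hs hy))) hcm
    have h2 : scaledVar b q i * rootFactor b q (q : ℂ)⁻¹ (i : ι) *
        slashTwistCoeff (sqrtConst b q) (l i) (scaledVar b q i) ∈ B' := by
      have : scaledVar b q i * rootFactor b q (q : ℂ)⁻¹ (i : ι) *
          slashTwistCoeff (sqrtConst b q) (l i) (scaledVar b q i) =
          scaledVar b q i ^ l i * ((-1) ^ l i * (sqrtConst b q + 1) * (scaledVar b q i - 1) *
            (sqrtConst b q + scaledVar b q i)) * (2 * sqrtConst b q ^ 2)⁻¹ := by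
        rw [hF, slashTwistCoeff]
        field_simp
      rw [this]
      exact mul_mem (mul_mem (pow_mem hy _) (mul_mem (mul_mem (mul_mem
        (pow_mem (neg_mem (one_mem _)) _) (add_mem hs (one_mem _))) (sub_mem hy (one_mem _)))
        (add_mem hs hy))) hcm
    have hprod : ∏ a ∈ inversions b (w * weylGroup.ofIdx P (i : ι)),
        rootMonomial b q a * rootFactor b q (q : ℂ)⁻¹ a =
        scaledVar b q i * rootFactor b q (q : ℂ)⁻¹ (i : ι) * reflectSubst b hq i
          (∏ a ∈ inversions b w, rootMonomial b q a * rootFactor b q (q : ℂ)⁻¹ a) := by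
      rw [hI, Finset.prod_insert (notMem_map_inversions i.2), Finset.prod_map,
        rootMonomial_simple, map_prod]
      simp only [Equiv.coe_toEmbedding, map_mul, reflectSubst_rootMonomial hsl,
        reflectSubst_rootFactor hsl]
    rw [hprod, hA.mul_ofIdx, simpleSlash_eq]
    set p := ∏ a ∈ inversions b w, rootMonomial b q a * rootFactor b q (q : ℂ)⁻¹ a with hp
    have k1 := mul_mem h1 (hR _ ih)
    have k2 := mul_mem h2 (hR _ (hE _ ih))
    rw [map_mul] at k1 k2
    rw [map_mul] at k2
    -- The sign acquired by the product decides between the sum and the difference of `k1` and `k2`.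
    rcases signSubst_prod_rootMonomial_mul hsl (q := q) i (q : ℂ)⁻¹ (inversions b w) with h | h
    · rw [← hp] at h
      rw [h] at k2
      convert add_mem k1 k2 using 1
      ring
    · rw [← hp] at h
      rw [h, map_neg] at k2
      convert sub_mem k1 k2 using 1
      ring

omit hsl [P.IsReduced] [P.IsCrystallographic] in
lemma average_eq (hq : q ≠ 0) [Fintype P.weylGroup] :
    average b q S A = ∑ w : P.weylGroup, (S w (Delta b q))⁻¹ * A w 1 := by
  have h0 := Delta_ne_zero (b := b) hq
  rw [average, Finset.mul_sum]
  refine Finset.sum_congr (by ext; simp) fun w _ ↦ ?_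
  field_simp

/-- Each term is a polynomial: `j(w, x)` supplies `Y_a²` for every inversion, of which one `Y_a`,
with the matching factor of `D`, clears `1|w`; the other `Y_a` and the unused factors of `D` are
polynomials. -/
lemma denom_mul_Delta_mul_average_mem
    (hS : IsRightActionExtending b (fun i f ↦ reflectSubst b hq i f) S)
    (hA : IsRightActionExtending b (simpleSlash b hq l) A) :
    denom b q * Delta b q * average b q S A ∈ polynomials b.support := by
  classical
  have : Fintype P.weylGroup := Fintype.ofFinite _
  rw [average_eq hq.ne_zero, Finset.mul_sum]
  refine sum_mem fun w _ ↦ ?_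
  obtain ⟨n, hn⟩ := Delta_eq_neg_one_pow_mul hsl hq hS w
  have hpos : ∀ a ∈ inversions b w, b.IsPos a := fun a ha ↦ (mem_inversions.mp ha).1
  have hsub : inversions b w ⊆ posRoots b := fun a ha ↦ mem_posRoots.mpr (hpos a ha)
  have hD0 : S w (Delta b q) ≠ 0 := by
    intro h
    rw [h, mul_zero] at hn
    exact Delta_ne_zero hq.ne_zero hn
  have hA' : (∏ a ∈ inversions b w, rootMonomial b q a * rootFactor b q (q : ℂ)⁻¹ a) * A w 1 ∈
      polynomials b.support := by
    refine Algebra.adjoin_le ?_ (slash_one_mem hsl hq l hA w)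
    rintro _ ⟨a, ha, rfl⟩
    exact rootMonomial_mem_polynomials (hpos a ha)
  have key : denom b q * Delta b q * ((S w (Delta b q))⁻¹ * A w 1) =
      (-1) ^ n * (∏ a ∈ posRoots b \ inversions b w, rootFactor b q (q : ℂ)⁻¹ a) *
        (∏ a ∈ inversions b w, rootMonomial b q a) *
        ((∏ a ∈ inversions b w, rootMonomial b q a * rootFactor b q (q : ℂ)⁻¹ a) * A w 1) := by
    rw [denom_eq hq.ne_zero, ← Finset.prod_sdiff hsub]
    conv_lhs => enter [1, 2]; rw [hn]
    simp only [Finset.prod_mul_distrib, Finset.prod_pow]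
    field_simp
  rw [key]
  refine mul_mem (mul_mem (mul_mem (pow_mem (neg_mem (one_mem _)) _) ?_) ?_) hA'
  · exact prod_mem fun a ha ↦
      rootFactor_mem_polynomials _ (mem_posRoots.mp (Finset.mem_sdiff.mp ha).1)
  · exact prod_mem fun a ha ↦ rootMonomial_mem_polynomials (hpos a ha)

/-- The operator carries the term `Δ(wx)⁻¹ (1|w)` to the term of `w s_i`, hence permutes the sum. -/
lemma simpleSlash_average
    (hS : IsRightActionExtending b (fun i f ↦ reflectSubst b hq i f) S)
    (hA : IsRightActionExtending b (simpleSlash b hq l) A) (i : b.support) :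
    simpleSlash b hq l i (average b q S A) = average b q S A := by
  have : Fintype P.weylGroup := Fintype.ofFinite _
  have hsum : ∀ (s : Finset P.weylGroup) (f : P.weylGroup → RatFun b.support),
      simpleSlash b hq l i (∑ w ∈ s, f w) = ∑ w ∈ s, simpleSlash b hq l i (f w) := by
    intro s f
    exact map_sum (AddMonoidHom.mk' _ (simpleSlash_add hq l i)) f s
  rw [average_eq hq.ne_zero, hsum]
  refine Finset.sum_equiv (Equiv.mulRight (weylGroup.ofIdx P (i : ι))) (by simp) fun w _ ↦ ?_
  -- `Δ(wx)` is `± Δ / ∏ Y_a²`, in which only squares of root monomials occur.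
  have hE : signSubst b i (S w (Delta b q))⁻¹ = (S w (Delta b q))⁻¹ := by
    obtain ⟨n, hn⟩ := Delta_eq_neg_one_pow_mul hsl hq hS w
    have h1 := congrArg (signSubst b i) hn
    have hE' : signSubst b i (∏ a ∈ inversions b w, rootMonomial b q a ^ 2) =
        ∏ a ∈ inversions b w, rootMonomial b q a ^ 2 := by
      rw [map_prod]
      exact Finset.prod_congr rfl fun a _ ↦ signSubst_scaledMonomial_sq hsl i _
    have hne : (-1 : RatFun b.support) ^ n * ∏ a ∈ inversions b w, rootMonomial b q a ^ 2 ≠ 0 :=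
      fun h ↦ Delta_ne_zero (b := b) hq.ne_zero (by rw [hn, h, zero_mul])
    rw [map_mul, map_mul, hE', map_pow, map_neg, map_one, Delta_eq hq.ne_zero,
      signSubst_prod_posRoots hsl, ← Delta_eq hq.ne_zero] at h1
    rw [map_inv₀, ← mul_left_cancel₀ hne (hn.symm.trans h1)]
  rw [simpleSlash_mul_of_signSubst_eq hq l hE, Equiv.coe_mulRight, hS.mul_ofIdx, hA.mul_ofIdx,
    map_inv₀]

end Slash

/-! ### Regularity along hyperplanes and Laurent polynomials -/

section Localization

variable {σ : Type*}

open MvPolynomial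

/-- The rational functions with a denominator in the submonoid `V`. -/
def withDenominators (V : Submonoid (MvPolynomial σ ℂ)) : Subalgebra ℂ (RatFun σ) where
  carrier := {f | ∃ v ∈ V, f * algebraMap _ (RatFun σ) v ∈ polynomials σ}
  mul_mem' := by
    rintro f g ⟨v, hv, hf⟩ ⟨w, hw, hg⟩
    refine ⟨v * w, mul_mem hv hw, ?_⟩
    rw [map_mul, mul_mul_mul_comm]
    exact mul_mem hf hg
  add_mem' := by
    rintro f g ⟨v, hv, hf⟩ ⟨w, hw, hg⟩
    refine ⟨v * w, mul_mem hv hw, ?_⟩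
    have : (f + g) * algebraMap _ (RatFun σ) (v * w) =
        f * algebraMap _ (RatFun σ) v * algebraMap _ (RatFun σ) w +
          g * algebraMap _ (RatFun σ) w * algebraMap _ (RatFun σ) v := by
      rw [map_mul]
      ring
    rw [this]
    exact add_mem (mul_mem hf (algebraMap_mem_polynomials w))
      (mul_mem hg (algebraMap_mem_polynomials v))
  algebraMap_mem' c := ⟨1, one_mem _, by
    rw [map_one, mul_one]
    exact Subalgebra.algebraMap_mem _ c⟩

lemma mem_withDenominators {V : Submonoid (MvPolynomial σ ℂ)} {f : RatFun σ} :
    f ∈ withDenominators V ↔ ∃ v ∈ V, f * algebraMap _ (RatFun σ) v ∈ polynomials σ := Iff.rfl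

lemma polynomials_le_withDenominators (V : Submonoid (MvPolynomial σ ℂ)) :
    polynomials σ ≤ withDenominators V := fun f hf ↦ ⟨1, one_mem _, by rwa [map_one, mul_one]⟩

lemma withDenominators_mono {V W : Submonoid (MvPolynomial σ ℂ)} (h : V ≤ W) :
    withDenominators V ≤ withDenominators W := fun _ ⟨v, hv, hf⟩ ↦ ⟨v, h hv, hf⟩

lemma inv_mem_withDenominators {V : Submonoid (MvPolynomial σ ℂ)} {v : MvPolynomial σ ℂ}
    (hv : v ∈ V) : (algebraMap _ (RatFun σ) v)⁻¹ ∈ withDenominators V := by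
  by_cases h : algebraMap _ (RatFun σ) v = 0
  · rw [h, inv_zero]
    exact zero_mem _
  · refine ⟨v, hv, ?_⟩
    rw [inv_mul_cancel₀ h]
    exact one_mem _

open Classical in
/-- The substitution `x_i = c` in a polynomial. -/
def evalVar (i : σ) (c : ℂ) : MvPolynomial σ ℂ →ₐ[ℂ] MvPolynomial σ ℂ :=
  aeval fun j ↦ if j = i then C c else X j

lemma evalVar_X_self (i : σ) (c : ℂ) : evalVar i c (X i) = C c := by
  rw [evalVar, aeval_X, if_pos rfl]

lemma evalVar_X_of_ne {i j : σ} (h : j ≠ i) (c : ℂ) : evalVar i c (X j) = X j := by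
  rw [evalVar, aeval_X, if_neg h]

lemma X_sub_C_dvd_sub_evalVar (i : σ) (c : ℂ) (p : MvPolynomial σ ℂ) :
    X i - C c ∣ p - evalVar i c p := by
  induction p using MvPolynomial.induction_on with
  | C a => simp [evalVar]
  | add p r hp hr =>
    rw [map_add, add_sub_add_comm]
    exact dvd_add hp hr
  | mul_X p j hp =>
    rw [map_mul]
    have h : X i - C c ∣ X j - evalVar i c (X j) := by
      by_cases hj : j = i
      · rw [hj, evalVar_X_self]
      · rw [evalVar_X_of_ne hj, sub_self]
        exact dvd_zero _
    have : p * X j - evalVar i c p * evalVar i c (X j) =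
        (p - evalVar i c p) * X j + evalVar i c p * (X j - evalVar i c (X j)) := by ring
    rw [this]
    exact dvd_add (hp.mul_right _) (h.mul_left _)

lemma eval_evalVar {i : σ} {c : ℂ} {z : σ → ℂ} (hz : z i = c) (p : MvPolynomial σ ℂ) :
    eval z (evalVar i c p) = eval z p := by
  suffices h : (aeval z).comp (evalVar i c) = aeval (R := ℂ) z by
    have := DFunLike.congr_fun h p
    simpa [aeval_eq_eval] using this
  refine MvPolynomial.algHom_ext fun j ↦ ?_
  rw [AlgHom.comp_apply]
  by_cases hj : j = i
  · rw [hj, evalVar_X_self, aeval_X, hz]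
    simp
  · rw [evalVar_X_of_ne hj]

lemma evalVar_ne_zero {i : σ} {c : ℂ} {z : σ → ℂ} (hz : z i = c) {p : MvPolynomial σ ℂ}
    (hp : eval z p ≠ 0) : evalVar i c p ≠ 0 := fun h ↦ hp (by
  rw [← eval_evalVar hz, h, map_zero])

/-- The rational functions that are regular at the generic point of the hyperplane `x_i = c`. -/
def regularAt (i : σ) (c : ℂ) : Subalgebra ℂ (RatFun σ) :=
  withDenominators ((nonZeroDivisors (MvPolynomial σ ℂ)).comap (evalVar i c))

lemma mem_regularAt {i : σ} {c : ℂ} {f : RatFun σ} : f ∈ regularAt i c ↔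
    ∃ v, evalVar i c v ≠ 0 ∧ f * algebraMap _ (RatFun σ) v ∈ polynomials σ := by
  simp [regularAt, mem_withDenominators]

lemma inv_mem_regularAt {i : σ} {c : ℂ} {v : MvPolynomial σ ℂ} (hv : evalVar i c v ≠ 0) :
    (algebraMap _ (RatFun σ) v)⁻¹ ∈ regularAt i c :=
  inv_mem_withDenominators (by simpa using hv)

/-- With `f = u/v`, `v` nonzero on the hyperplane, and `g = f (x_i - c)`, the relation `g v = u (x_i
- c)` makes `g` vanish on the hyperplane, so `x_i - c` divides `g`. -/
lemma mem_polynomials_of_mem_regularAt {i : σ} {c : ℂ} {f : RatFun σ} (hf : f ∈ regularAt i c)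
    (h : f * (var i - algebraMap ℂ _ c) ∈ polynomials σ) : f ∈ polynomials σ := by
  obtain ⟨v, hv, u, hu⟩ := mem_regularAt.mp hf
  obtain ⟨g, hg⟩ := h
  change algebraMap (MvPolynomial σ ℂ) (RatFun σ) u = _ at hu
  change algebraMap (MvPolynomial σ ℂ) (RatFun σ) g = _ at hg
  have hx : (var i - algebraMap ℂ _ c : RatFun σ) = algebraMap _ (RatFun σ) (X i - C c) := by
    rw [map_sub, algebraMap_C]
    rfl
  have hx0 : (var i - algebraMap ℂ _ c : RatFun σ) ≠ 0 := by
    rw [hx, ne_eq, FaithfulSMul.algebraMap_eq_zero_iff]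
    intro h0
    have := congrArg (eval fun _ ↦ c + 1) h0
    simp at this
  rw [hx] at hg
  have h1 : g * v = u * (X i - C c) := by
    apply IsFractionRing.injective (MvPolynomial σ ℂ) (RatFun σ)
    rw [map_mul, map_mul, hg, hu]
    ring
  have h2 := congrArg (evalVar i c) h1
  rw [map_mul, map_mul, map_sub, evalVar_X_self, evalVar, algHom_C, algebraMap_eq, sub_self,
    mul_zero] at h2
  have h3 : evalVar i c g = 0 := (mul_eq_zero.mp h2).resolve_right hv
  have h4 := X_sub_C_dvd_sub_evalVar i c g
  rw [h3, sub_zero] at h4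
  obtain ⟨g', rfl⟩ := h4
  refine ⟨g', ?_⟩
  change algebraMap (MvPolynomial σ ℂ) (RatFun σ) g' = f
  apply mul_right_cancel₀ hx0
  rw [hx, ← hg, map_mul, mul_comm]

/-- The algebra of Laurent polynomials. -/
def laurent (σ : Type*) : Subalgebra ℂ (RatFun σ) :=
  withDenominators (Submonoid.closure (Set.range X))

lemma polynomials_le_laurent : polynomials σ ≤ laurent σ := polynomials_le_withDenominators _

lemma polynomials_le_regularAt (i : σ) (c : ℂ) : polynomials σ ≤ regularAt i c :=
  polynomials_le_withDenominators _

lemma laurent_le_regularAt (i : σ) {c : ℂ} (hc : c ≠ 0) : laurent σ ≤ regularAt i c := by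
  refine withDenominators_mono ?_
  rw [Submonoid.closure_le]
  rintro _ ⟨j, rfl⟩
  rw [SetLike.mem_coe, Submonoid.mem_comap, mem_nonZeroDivisors_iff_ne_zero]
  by_cases hj : j = i
  · rw [hj, evalVar_X_self]
    simpa using hc
  · rw [evalVar_X_of_ne hj]
    exact X_ne_zero j

lemma mem_laurent_of_mem_regularAt {i : σ} {c : ℂ} {f : RatFun σ}
    (hf : f ∈ regularAt i c) (h : f * (var i - algebraMap ℂ _ c) ∈ laurent σ) :
    f ∈ laurent σ := by
  obtain ⟨m, hm, hfm⟩ := h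
  refine ⟨m, hm, mem_polynomials_of_mem_regularAt (i := i) (c := c) ?_ ?_⟩
  · exact mul_mem hf (polynomials_le_regularAt i c (algebraMap_mem_polynomials m))
  · rwa [mul_right_comm]

/-- The monomial denominator is removed one variable at a time, using regularity along `x_i = 0` for
each. -/
lemma mem_polynomials_of_mem_laurent {f : RatFun σ} (hf : f ∈ laurent σ)
    (h : ∀ i, f ∈ regularAt i 0) : f ∈ polynomials σ := by
  obtain ⟨m, hm, hfm⟩ := hf
  induction hm using Submonoid.closure_induction generalizing f with
  | mem x hx =>
    obtain ⟨i, rfl⟩ := hx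
    refine mem_polynomials_of_mem_regularAt (h i) ?_
    rwa [map_zero, sub_zero]
  | one => simpa using hfm
  | mul x y hx hy ihx ihy =>
    refine ihx h (ihy (fun i ↦ mul_mem (h i) ?_) ?_)
    · exact polynomials_le_regularAt i 0 (algebraMap_mem_polynomials x)
    · rwa [mul_assoc, ← map_mul]

lemma var_mem_polynomials (j : σ) : (var j : RatFun σ) ∈ polynomials σ :=
  algebraMap_mem_polynomials (X j)

lemma var_inv_mem_laurent (j : σ) : (var j : RatFun σ)⁻¹ ∈ laurent σ :=
  inv_mem_withDenominators (Submonoid.subset_closure ⟨j, rfl⟩)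

lemma map_mem_of_mem_polynomials {L : Subalgebra ℂ (RatFun σ)} (g : RatFun σ →ₐ[ℂ] RatFun σ)
    (h : ∀ j, g (var j) ∈ L) {f : RatFun σ} (hf : f ∈ polynomials σ) : g f ∈ L := by
  obtain ⟨p, hp⟩ := hf
  change algebraMap (MvPolynomial σ ℂ) (RatFun σ) p = _ at hp
  rw [← hp]
  clear hp
  induction p using MvPolynomial.induction_on with
  | C a =>
    rw [algebraMap_C, AlgHom.commutes]
    exact Subalgebra.algebraMap_mem _ _
  | add p q hp hq =>
    rw [map_add, map_add]
    exact add_mem hp hq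
  | mul_X p j hp =>
    rw [map_mul, map_mul]
    exact mul_mem hp (h j)

lemma map_mem_of_mem_laurent {L : Subalgebra ℂ (RatFun σ)} (g : RatFun σ →ₐ[ℂ] RatFun σ)
    (h : ∀ j, g (var j) ∈ L) (h' : ∀ j, (g (var j))⁻¹ ∈ L) {f : RatFun σ} (hf : f ∈ laurent σ) :
    g f ∈ L := by
  obtain ⟨m, hm, hfm⟩ := hf
  have key : m ≠ 0 ∧ (g (algebraMap _ (RatFun σ) m))⁻¹ ∈ L := by
    clear hfm
    induction hm using Submonoid.closure_induction with
    | mem x hx =>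
      obtain ⟨i, rfl⟩ := hx
      exact ⟨X_ne_zero i, h' i⟩
    | one => simp [one_mem]
    | mul x y hx hy ihx ihy =>
      rw [map_mul, map_mul, mul_inv]
      exact ⟨mul_ne_zero ihx.1 ihy.1, mul_mem ihx.2 ihy.2⟩
  have h2 : g (algebraMap _ (RatFun σ) m) ≠ 0 := by
    rw [map_ne_zero, ne_eq, FaithfulSMul.algebraMap_eq_zero_iff]
    exact key.1
  have h1 := mul_mem (map_mem_of_mem_polynomials g h hfm) key.2
  rwa [map_mul, mul_assoc, mul_inv_cancel₀ h2, mul_one] at h1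

end Localization

/-! ### Root factors and reflections on the hyperplanes `y_i = c` -/

section Regularity

open MvPolynomial

variable {ι M N : Type*} [AddCommGroup M] [Module ℝ M] [AddCommGroup N] [Module ℝ N]
  {P : RootPairing ι ℝ M N} {b : P.Base} {q : ℕ}

lemma scaledVar_mem_polynomials (j : b.support) : scaledVar b q j ∈ polynomials b.support :=
  ⟨_, algebraMap_C_mul_X j⟩

lemma scaledVar_inv_mem_laurent (j : b.support) : (scaledVar b q j)⁻¹ ∈ laurent b.support := by
  rw [scaledVar, mul_inv, sqrtConst, ← map_inv₀]
  exact mul_mem (Subalgebra.algebraMap_mem _ _) (var_inv_mem_laurent j)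

lemma zpow_mem_of_inv_mem {K : Type*} [Field K] [Algebra ℂ K] {L : Subalgebra ℂ K} {x : K}
    (h : x ∈ L) (h' : x⁻¹ ∈ L) (n : ℤ) : x ^ n ∈ L := by
  obtain ⟨k, rfl | rfl⟩ := n.eq_nat_or_neg
  · rw [zpow_natCast]
    exact pow_mem h k
  · rw [zpow_neg, zpow_natCast, ← inv_pow]
    exact pow_mem h' k

lemma scaledVar_mem_laurent (j : b.support) : scaledVar b q j ∈ laurent b.support :=
  polynomials_le_laurent (scaledVar_mem_polynomials j)

lemma rootMonomial_mem_laurent (a : ι) : rootMonomial b q a ∈ laurent b.support :=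
  prod_mem fun j _ ↦
    zpow_mem_of_inv_mem (scaledVar_mem_laurent j) (scaledVar_inv_mem_laurent j) _

lemma scaledVar_sub_algebraMap (hq : q ≠ 0) (i : b.support) (c : ℂ) :
    scaledVar b q i - algebraMap ℂ _ c =
      algebraMap ℂ _ (Real.sqrt q : ℂ) * (var i - algebraMap ℂ _ (c / (Real.sqrt q : ℂ))) := by
  have hs := sqrtConst_ne_zero (b := b) hq
  change _ = sqrtConst b q * _
  rw [scaledVar, map_div₀]
  change _ = _ * (_ - _ / sqrtConst b q)
  field_simp

/-- Otherwise the root would be a multiple of `α_i`, and a base admits only `±α_i` among these. -/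
lemma exists_ne_repr_pos [Finite ι] {a : ι} {i : b.support} (ha : b.IsPos a) (hai : a ≠ i) :
    ∃ j ≠ i, 0 < b.toWeightBasisInt.repr (P.rootSpanMem ℤ a) j := by
  by_contra! h
  have h0 : ∀ j, j ≠ i → b.toWeightBasisInt.repr (P.rootSpanMem ℤ a) j = 0 := fun j hj ↦
    le_antisymm (h j hj) (repr_rootSpanMem_nonneg ha j)
  have h1 : P.root a = b.toWeightBasisInt.repr (P.rootSpanMem ℤ a) i • P.root i := by
    have := congrArg Subtype.val (b.toWeightBasisInt.sum_repr (P.rootSpanMem ℤ a))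
    rw [Finset.sum_eq_single i (fun j _ hj ↦ by rw [h0 j hj, zero_smul]) (by simp)] at this
    simpa using this.symm
  have : IsAddTorsionFree M := .of_isTorsionFree ℝ M
  have : IsAddTorsionFree N := .of_isTorsionFree ℝ N
  have h2 := b.eq_one_or_neg_one_of_mem_support_of_smul_mem (i : ι) i.2
    (b.toWeightBasisInt.repr (P.rootSpanMem ℤ a) i : ℝ) ⟨a, by rw [h1, Int.cast_smul_eq_zsmul]⟩
  have h3 := repr_rootSpanMem_nonneg ha i
  have h4 : b.toWeightBasisInt.repr (P.rootSpanMem ℤ a) i = 1 := by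
    rcases h2 with h2 | h2
    · exact_mod_cast h2
    · have : b.toWeightBasisInt.repr (P.rootSpanMem ℤ a) i = -1 := by exact_mod_cast h2
      omega
  rw [h4, one_smul] at h1
  exact hai (P.root.injective h1)

open Classical in
lemma eval_rootPolynomial_of_ne [Finite ι] {a : ι} {i : b.support} (ha : b.IsPos a) (hai : a ≠ i)
    (z : ℂ) : eval (fun j ↦ if j = i then z else 0) (rootPolynomial b q a) = 0 := by
  obtain ⟨j, hj, hpos⟩ := exists_ne_repr_pos ha hai
  rw [rootPolynomial, map_prod]
  refine Finset.prod_eq_zero (Finset.mem_univ j) ?_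
  rw [map_pow, map_mul, eval_X, if_neg hj, mul_zero, zero_pow]
  omega

open Classical in
lemma eval_rootPolynomial_self (hq : q ≠ 0) (i : b.support) (c : ℂ) :
    eval (fun j ↦ if j = i then c / (Real.sqrt q : ℂ) else 0) (rootPolynomial b q (i : ι)) = c := by
  have hs := sqrt_ne_zero hq
  rw [rootPolynomial, map_prod, ← toWeightBasisInt_eq, Module.Basis.repr_self,
    Finset.prod_eq_single i]
  · simp
    field_simp
  · intro j _ hj
    rw [Finsupp.single_apply, if_neg (Ne.symm hj)]
    simp
  · simp

/-- One point of the hyperplane `y_i = c` where the factor is nonzero suffices. With all other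
coordinates zero, `Y_a` is `c` at `α_i` and `0` at every other positive root. -/
lemma rootFactor_inv_mem_regularAt [Finite ι] (hq : q ≠ 0) {a : ι} {i : b.support} {κ c : ℂ}
    (ha : b.IsPos a) (h : a ≠ i ∨ κ * c ^ 2 ≠ 1) :
    (rootFactor b q κ a)⁻¹ ∈ regularAt i (c / (Real.sqrt q : ℂ)) := by
  classical
  rw [← algebraMap_one_sub_rootPolynomial κ ha]
  refine inv_mem_regularAt
    (evalVar_ne_zero (z := fun j ↦ if j = i then c / (Real.sqrt q : ℂ) else 0) (if_pos rfl) ?_)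
  rw [map_sub, map_one, map_mul, map_pow, eval_C]
  by_cases hai : a = i
  · rw [hai, eval_rootPolynomial_self hq]
    rw [hai] at h
    rw [sub_ne_zero]
    exact (h.resolve_left fun h ↦ h rfl).symm
  · rw [eval_rootPolynomial_of_ne ha hai]
    simp

lemma scaledVar_add_inv_mem_regularAt (hq : q ≠ 0) {i : b.support} {c : ℂ} (hc : c ≠ 0) :
    (scaledVar b q i + algebraMap ℂ _ c)⁻¹ ∈ regularAt i (c / (Real.sqrt q : ℂ)) := by
  have hs := sqrt_ne_zero hq
  have h : scaledVar b q i + algebraMap ℂ _ c =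
      algebraMap _ (RatFun b.support) (C (Real.sqrt q : ℂ) * X i + C c) := by
    rw [map_add, algebraMap_C_mul_X, algebraMap_C]
  rw [h]
  refine inv_mem_regularAt (evalVar_ne_zero (z := fun _ ↦ c / (Real.sqrt q : ℂ)) rfl ?_)
  simp only [map_add, map_mul, eval_C, eval_X]
  rw [mul_div_cancel₀ _ hs, ← two_mul]
  exact mul_ne_zero two_ne_zero hc

lemma Delta_inv_mem_regularAt_zero [Fintype ι] (hq : q ≠ 0) (i : b.support) :
    (Delta b q)⁻¹ ∈ regularAt i 0 := by
  rw [Delta_eq hq, ← Finset.prod_inv_distrib]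
  refine prod_mem fun a ha ↦ ?_
  have := rootFactor_inv_mem_regularAt (b := b) hq (i := i) (κ := 1) (c := 0)
    (mem_posRoots.mp ha) (Or.inr (by norm_num))
  rwa [zero_div] at this

variable [Finite ι] [P.IsCrystallographic] (hsl : b.cartanMatrix.IsSimplyLaced) (hq : IsPrimePow q)

include hsl

/-- On the hyperplane `y_i = c` with `c = ±1`, the substitution `σ_i` restricts to the identity or
to `ε_i`. -/
lemma reflectSubst_congr {i : b.support} {c : ℂ} (hc : c = 1 ∨ c = -1)
    {T : RatFun b.support →ₐ[ℂ] RatFun b.support}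
    (hT : ∀ j, T (scaledVar b q j) = algebraMap ℂ _ (c ^ b.cartanMatrix j i) * scaledVar b q j)
    {f : RatFun b.support} (hf : f ∈ polynomials b.support) :
    ∃ h ∈ regularAt i (c / (Real.sqrt q : ℂ)),
      reflectSubst b hq i f = T f + (scaledVar b q i - algebraMap ℂ _ c) * h := by
  set O := regularAt i (c / (Real.sqrt q : ℂ)) with hO
  have hs := sqrt_ne_zero hq.ne_zero
  have hc0 : c ≠ 0 := by rcases hc with rfl | rfl <;> norm_num
  have hle : laurent b.support ≤ O := laurent_le_regularAt i (div_ne_zero hc0 hs)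
  have hy := scaledVar_ne_zero (b := b) hq.ne_zero i
  have hyO : scaledVar b q i ∈ O := hle (scaledVar_mem_laurent i)
  have hyO' : (scaledVar b q i)⁻¹ ∈ O := hle (scaledVar_inv_mem_laurent i)
  have hcO : ∀ z : ℂ, algebraMap ℂ (RatFun b.support) z ∈ O := fun z ↦ Subalgebra.algebraMap_mem _ z
  have hcc : algebraMap ℂ (RatFun b.support) c * algebraMap ℂ (RatFun b.support) c = 1 := by
    rcases hc with rfl | rfl <;> simp
  obtain ⟨p, rfl⟩ := hf
  change ∃ h ∈ O, reflectSubst b hq i (algebraMap _ _ p) = T (algebraMap _ _ p) + _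
  have hgen : ∀ j, ∃ h ∈ O, reflectSubst b hq i (scaledVar b q j) =
      T (scaledVar b q j) + (scaledVar b q i - algebraMap ℂ _ c) * h := by
    intro j
    rw [reflectSubst_scaledVar hsl, hT]
    have hjO : scaledVar b q j ∈ O := hle (scaledVar_mem_laurent j)
    by_cases hji : j = i
    · rw [hji, b.cartanMatrix_apply_same, zpow_ofNat, map_pow]
      -- Since `c² = 1`, `y_i⁻¹ - y_i = -y_i⁻¹ (y_i - c)(y_i + c)`.
      refine ⟨-(scaledVar b q i)⁻¹ * (scaledVar b q i + algebraMap ℂ _ c),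
        mul_mem (neg_mem hyO') (add_mem hyO (hcO c)), ?_⟩
      rw [pow_two, hcc, zpow_neg, zpow_ofNat]
      field_simp
      linear_combination -hcc
    · rcases hsl hji with h | h
      · refine ⟨0, zero_mem _, ?_⟩
        rw [h]
        simp
      · refine ⟨scaledVar b q j, hjO, ?_⟩
        have : c⁻¹ = c := by rcases hc with rfl | rfl <;> norm_num
        rw [h, neg_neg, zpow_one, zpow_neg_one, this]
        ring
  have hx : ∀ j, (var j : RatFun b.support) =
      algebraMap ℂ _ (Real.sqrt q : ℂ)⁻¹ * scaledVar b q j := by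
    intro j
    rw [scaledVar, map_inv₀, sqrtConst, inv_mul_cancel_left₀]
    exact sqrtConst_ne_zero hq.ne_zero
  have hTO : ∀ j, T (var j) ∈ O := fun j ↦ by
    rw [hx, map_mul, hT, AlgHom.commutes]
    exact mul_mem (hcO _) (mul_mem (hcO _) (hle (scaledVar_mem_laurent j)))
  induction p using MvPolynomial.induction_on with
  | C a =>
    refine ⟨0, zero_mem _, ?_⟩
    rw [algebraMap_C, AlgHom.commutes, AlgHom.commutes, mul_zero, add_zero]
  | add p r hp hr =>
    obtain ⟨h1, h1O, e1⟩ := hp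
    obtain ⟨h2, h2O, e2⟩ := hr
    refine ⟨h1 + h2, add_mem h1O h2O, ?_⟩
    rw [map_add, map_add, map_add, e1, e2]
    ring
  | mul_X p j hp =>
    obtain ⟨h1, h1O, e1⟩ := hp
    obtain ⟨h2, h2O, e2⟩ := hgen j
    have hpO : T (algebraMap _ _ p) ∈ O :=
      map_mem_of_mem_polynomials T hTO (algebraMap_mem_polynomials p)
    have hXj : algebraMap (MvPolynomial b.support ℂ) (RatFun b.support) (X j) =
      algebraMap ℂ _ (Real.sqrt q : ℂ)⁻¹ * scaledVar b q j := hx j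
    have hTX : T (scaledVar b q j) ∈ O := by
      rw [hT]
      exact mul_mem (hcO _) (hle (scaledVar_mem_laurent j))
    -- The cofactor of `y_i - c` in the product of the congruences for `p` and `y_j`, rescaled by
    -- `x_j = y_j/√q`.
    refine ⟨algebraMap ℂ _ (Real.sqrt q : ℂ)⁻¹ * (T (algebraMap _ _ p) * h2 +
      h1 * T (scaledVar b q j) + (scaledVar b q i - algebraMap ℂ _ c) * h1 * h2), ?_, ?_⟩
    · exact mul_mem (hcO _) (add_mem (add_mem (mul_mem hpO h2O) (mul_mem h1O hTX))
        (mul_mem (mul_mem (sub_mem hyO (hcO _)) h1O) h2O))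
    · simp only [map_mul, e1, hXj, e2, AlgHom.commutes]
      ring

end Regularity

/-- The functional equation of `F = D Δ f` when `f |_ℓ σ_i = f`. -/
lemma functional_equation {ι M N : Type*} [Fintype ι] [AddCommGroup M] [Module ℝ M]
    [AddCommGroup N] [Module ℝ N] {P : RootPairing ι ℝ M N} [P.IsCrystallographic] [P.IsReduced]
    {b : P.Base} (hsl : b.cartanMatrix.IsSimplyLaced) {q : ℕ} (hq : IsPrimePow q)
    (l : b.support → ℕ) {i : b.support} {f : RatFun b.support}
    (hf : simpleSlash b hq l i f = f) :
    2 * (sqrtConst b q ^ 2 * scaledVar b q i ^ 2 - 1) * (denom b q * Delta b q * f) =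
      -scaledVar b q i ^ (l i + 3) * (sqrtConst b q + scaledVar b q i) *
        ((sqrtConst b q - 1) * (1 + scaledVar b q i) *
            reflectSubst b hq i (denom b q * Delta b q * f) +
          (-1) ^ l i * (sqrtConst b q + 1) * (scaledVar b q i - 1) *
            reflectSubst b hq i (signSubst b i (denom b q * Delta b q * f))) := by
  have hs := sqrtConst_ne_zero (b := b) hq.ne_zero
  have hy := scaledVar_ne_zero (b := b) hq.ne_zero i
  have hsy := sqrtConst_sub_scaledVar_ne_zero (b := b) hq.ne_zero i
  have hD := reflectSubst_prod_posRoots hsl hq i (q : ℂ)⁻¹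
  rw [← denom_eq hq.ne_zero, map_inv₀, map_natCast, ← sqrtConst_sq (b := b)] at hD
  have hΔ := reflectSubst_Delta hsl hq i
  have hED : signSubst b i (denom b q) = denom b q := by
    rw [denom_eq hq.ne_zero, signSubst_prod_posRoots hsl]
  have hEΔ : signSubst b i (Delta b q) = Delta b q := by
    rw [Delta_eq hq.ne_zero, signSubst_prod_posRoots hsl]
  rw [simpleSlash_eq, slashCoeff, slashTwistCoeff] at hf
  simp only [map_mul, hED, hEΔ]
  generalize reflectSubst b hq i f = Rf at *
  generalize reflectSubst b hq i (signSubst b i f) = REf at *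
  generalize reflectSubst b hq i (denom b q) = RD at *
  generalize reflectSubst b hq i (Delta b q) = RΔ at *
  generalize denom b q = D at *
  generalize Delta b q = Δ at *
  generalize scaledVar b q i = y at *
  generalize sqrtConst b q = s at *
  -- The laws of `D` and `f` are freed of denominators; combined with that of `Δ` they give the
  -- equation.
  have hD' : RD * (s ^ 2 - y ^ 2) * y ^ 2 = (s ^ 2 * y ^ 2 - 1) * D := by
    field_simp at hD
    linear_combination hD
  have hf' : y ^ l i * ((s - 1) * (1 + y) * Rf + (-1) ^ l i * (s + 1) * (y - 1) * REf) =
      2 * y * (s - y) * f := by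
    rw [← hf]
    field_simp
  rw [pow_add]
  linear_combination y ^ 3 * (s + y) * RD * RΔ * hf' + 2 * f * y ^ 2 * RΔ * hD' +
    2 * f * (s ^ 2 * y ^ 2 - 1) * D * hΔ

/-! ### Vanishing of `D Δ f` on `y_i = ±1` -/

section Regular

open MvPolynomial

variable {ι M N : Type*} [Fintype ι] [AddCommGroup M] [Module ℝ M] [AddCommGroup N] [Module ℝ N]
  {P : RootPairing ι ℝ M N} [P.IsCrystallographic] [P.IsReduced] {b : P.Base}
  (hsl : b.cartanMatrix.IsSimplyLaced) {q : ℕ} (hq : IsPrimePow q) (l : b.support → ℕ)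

omit [Fintype ι] [P.IsCrystallographic] [P.IsReduced] in
lemma exists_scaledVar_pow_eq (i : b.support) (c : ℂ) (n : ℕ) :
    ∃ h ∈ polynomials b.support, scaledVar b q i ^ n =
      algebraMap ℂ _ (c ^ n) + (scaledVar b q i - algebraMap ℂ _ c) * h := by
  induction n with
  | zero => exact ⟨0, zero_mem _, by simp⟩
  | succ n ih =>
    obtain ⟨h, hh, e⟩ := ih
    refine ⟨h * scaledVar b q i + algebraMap ℂ _ (c ^ n), add_mem
      (mul_mem hh (scaledVar_mem_polynomials i)) (Subalgebra.algebraMap_mem _ _), ?_⟩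
    rw [pow_succ, e, pow_succ, map_mul]
    ring

include hsl

/-- On `y_i = 1` the factor `y_i - 1` kills the second term of the functional equation; on `y_i =
-1` the factor `1 + y_i` kills the first. By `reflectSubst_congr` the surviving substitution
restricts to `F` itself, and the equation reads `2(q - 1) F = -2(q - 1) F`. -/
lemma exists_eq_sub_mul {i : b.support} {f : RatFun b.support}
    (hf : simpleSlash b hq l i f = f)
    (hpoly : denom b q * Delta b q * f ∈ polynomials b.support) {c : ℂ} (hc : c = 1 ∨ c = -1) :
    ∃ h ∈ regularAt i (c / (Real.sqrt q : ℂ)), denom b q * Delta b q * f =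
      (scaledVar b q i - algebraMap ℂ _ c) * h := by
  have hFE := functional_equation hsl hq l hf
  set F := denom b q * Delta b q * f with hF
  set O := regularAt i (c / (Real.sqrt q : ℂ)) with hO
  have hc0 : c ≠ 0 := by rcases hc with rfl | rfl <;> norm_num
  have hple : polynomials b.support ≤ O := polynomials_le_regularAt _ _
  have hE : ∀ j, signSubst b i (scaledVar b q j) =
      algebraMap ℂ _ ((-1 : ℂ) ^ b.cartanMatrix j i) * scaledVar b q j := by
    intro j
    rw [signSubst_scaledVar hsl, map_zpow₀, map_neg, map_one]
  have hEF : signSubst b i F ∈ polynomials b.support := by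
    refine map_mem_of_mem_polynomials _ (fun j ↦ ?_) hpoly
    rw [signSubst, substitute_var, signTuple]
    split_ifs
    · exact neg_mem (var_mem_polynomials j)
    · exact var_mem_polynomials j
  have hyO : scaledVar b q i ∈ O := hple (scaledVar_mem_polynomials i)
  have hsO : sqrtConst b q ∈ O := Subalgebra.algebraMap_mem _ _
  have hFO : F ∈ O := hple hpoly
  have h1O : (1 : RatFun b.support) ∈ O := one_mem _
  have h2O : (2 : RatFun b.support) ∈ O := ofNat_mem _ 2
  obtain ⟨h3, hh3, e3⟩ := exists_scaledVar_pow_eq (b := b) (q := q) i c (l i + 3)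
  replace hh3 := hple hh3
  -- The constant left after collecting both sides; it is invertible because `q > 1`.
  have hk : (4 * ((q : ℂ) - 1)) ≠ 0 := by
    refine mul_ne_zero (by norm_num) (sub_ne_zero.mpr ?_)
    exact_mod_cast hq.one_lt.ne'
  have hk' : algebraMap ℂ (RatFun b.support) (4 * ((q : ℂ) - 1)) = 4 * (sqrtConst b q ^ 2 - 1) := by
    rw [map_mul, map_sub, map_natCast, map_one, map_ofNat, sqrtConst_sq]
  suffices h : ∃ h ∈ O, 4 * (sqrtConst b q ^ 2 - 1) * F =
      (scaledVar b q i - algebraMap ℂ _ c) * h by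
    obtain ⟨h, hh, e⟩ := h
    refine ⟨algebraMap ℂ _ (4 * ((q : ℂ) - 1))⁻¹ * h, mul_mem (Subalgebra.algebraMap_mem _ _) hh, ?_⟩
    have hk0 : algebraMap ℂ (RatFun b.support) (4 * ((q : ℂ) - 1)) ≠ 0 :=
      (map_ne_zero _).mpr hk
    rw [map_inv₀, mul_left_comm, ← e, ← hk', inv_mul_cancel_left₀ hk0]
  rcases hc with rfl | rfl
  · obtain ⟨h1, hh1, e1⟩ := reflectSubst_congr hsl hq (i := i) (c := 1) (Or.inl rfl)
      (T := AlgHom.id ℂ _) (by simp) hpoly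
    obtain ⟨h2, hh2, e2⟩ := reflectSubst_congr hsl hq (i := i) (c := 1) (Or.inl rfl)
      (T := AlgHom.id ℂ _) (by simp) hEF
    replace hEF := hple hEF
    simp only [AlgHom.id_apply, one_pow, map_one] at e1 e2 e3 ⊢
    rw [e1, e2] at hFE
    generalize signSubst b i F = EF at *
    generalize scaledVar b q i = y at *
    generalize sqrtConst b q = s at *
    -- The first two terms come from the second term of the equation and the error `h1`. The last
    -- is, up to sign, the coefficient of `F` minus its value `4(s² - 1)` at `y = 1`, divided by `y
    -- - 1`. The case `y = -1` is analogous.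
    refine ⟨-(y ^ (l i + 3) * (s + y) * (s + 1) * (-1) ^ l i * (EF + (y - 1) * h2)) -
      y ^ (l i + 3) * (s + y) * (s - 1) * (1 + y) * h1 -
      (2 * s ^ 2 * (y + 1) + h3 * (s + y) * (s - 1) * (1 + y) + (s - 1) * (y + s + 2)) * F, ?_, ?_⟩
    · repeat' first | assumption | apply add_mem | apply sub_mem | apply neg_mem | apply mul_mem |
        apply pow_mem
    · linear_combination hFE - (s + y) * (s - 1) * (1 + y) * F * e3
  · obtain ⟨h2, hh2, e2⟩ := reflectSubst_congr hsl hq (i := i) (c := -1) (Or.inr rfl)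
      (T := signSubst b i) hE hEF
    obtain ⟨h1, hh1, e1⟩ := reflectSubst_congr hsl hq (i := i) (c := -1) (Or.inr rfl)
      (T := signSubst b i) hE hpoly
    rw [signSubst_signSubst hsl] at e2
    replace hEF := hple hEF
    simp only [map_neg, map_one, map_pow] at e1 e2 e3 ⊢
    rw [e1, e2] at hFE
    generalize signSubst b i F = EF at *
    generalize scaledVar b q i = y at *
    generalize sqrtConst b q = s at *
    have hε : ((-1 : RatFun b.support) ^ l i) * (-1) ^ l i = 1 := by
      rw [← mul_pow]
      norm_num
    refine ⟨-(y ^ (l i + 3) * (s + y) * (s - 1) * (EF + (y + 1) * h1)) -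
      y ^ (l i + 3) * (s + y) * (-1) ^ l i * (s + 1) * (y - 1) * h2 -
      (2 * s ^ 2 * (y - 1) - (s + 1) * (y + s - 2) +
        (-1) ^ l i * h3 * (s + y) * (s + 1) * (y - 1)) * F, ?_, ?_⟩
    · repeat' first | assumption | apply add_mem | apply sub_mem | apply neg_mem | apply mul_mem |
        apply pow_mem
    · linear_combination hFE - (s + y) * (-1) ^ l i * (s + 1) * (y - 1) * F * e3 +
        (s + y) * (s + 1) * (y - 1) * F * hε

end Regular

/-! ### Sign changes and factors of `D` along the simple divisors -/

section Sign

open MvPolynomial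

variable {ι M N : Type*} [Finite ι] [AddCommGroup M] [Module ℝ M] [AddCommGroup N] [Module ℝ N]
  {P : RootPairing ι ℝ M N} [P.IsCrystallographic] {b : P.Base} {q : ℕ}

open Classical in
/-- The sign by which `ε_i` acts on `x_j`. -/
def signAt (b : P.Base) (i j : b.support) : ℂ := if Adjacent b i j then -1 else 1

omit [Finite ι] in
lemma signAt_mul_self (i j : b.support) : signAt b i j * signAt b i j = 1 := by
  rw [signAt]
  split_ifs <;> norm_num

lemma signSubst_var (i j : b.support) :
    signSubst b i (var j) = algebraMap ℂ _ (signAt b i j) * var j := by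
  rw [signSubst, substitute_var, signTuple, signAt]
  split_ifs <;> simp

/-- The substitution `x ↦ ε_i x` on polynomials. -/
def signPoly (b : P.Base) (i : b.support) :
    MvPolynomial b.support ℂ →ₐ[ℂ] MvPolynomial b.support ℂ :=
  aeval fun j ↦ C (signAt b i j) * X j

lemma algebraMap_signPoly (i : b.support) (p : MvPolynomial b.support ℂ) :
    algebraMap _ (RatFun b.support) (signPoly b i p) =
      signSubst b i (algebraMap _ (RatFun b.support) p) := by
  suffices h : (IsScalarTower.toAlgHom ℂ (MvPolynomial b.support ℂ) (RatFun b.support)).comp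
      (signPoly b i) = (signSubst b i).comp
        (IsScalarTower.toAlgHom ℂ (MvPolynomial b.support ℂ) (RatFun b.support)) from
    DFunLike.congr_fun h p
  refine MvPolynomial.algHom_ext fun j ↦ ?_
  change algebraMap _ (RatFun b.support) (signPoly b i (X j)) = signSubst b i (var j)
  rw [signSubst_var, signPoly, aeval_X, map_mul, algebraMap_C]
  rfl

omit [Finite ι] in
lemma signPoly_injective (i : b.support) : Function.Injective (signPoly b i) := by
  have h : (signPoly b i).comp (signPoly b i) = AlgHom.id ℂ _ := by
    refine MvPolynomial.algHom_ext fun j ↦ ?_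
    rw [AlgHom.comp_apply, signPoly, aeval_X, map_mul, aeval_X, algHom_C, algebraMap_eq, ← mul_assoc,
      ← C_mul, signAt_mul_self, C_1, one_mul, AlgHom.id_apply]
  exact Function.LeftInverse.injective (g := signPoly b i) fun p ↦ DFunLike.congr_fun h p

omit [Finite ι] in
lemma evalVar_signPoly (i j : b.support) (c : ℂ) (p : MvPolynomial b.support ℂ) :
    evalVar i (signAt b j i * c) (signPoly b j p) = signPoly b j (evalVar i c p) := by
  suffices h : (evalVar i (signAt b j i * c)).comp (signPoly b j) =
      (signPoly b j).comp (evalVar i c) from DFunLike.congr_fun h p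
  refine MvPolynomial.algHom_ext fun k ↦ ?_
  rw [AlgHom.comp_apply, AlgHom.comp_apply]
  by_cases hk : k = i
  · rw [hk, evalVar_X_self, signPoly, aeval_X, map_mul, evalVar_X_self, algHom_C, algHom_C,
      algebraMap_eq, ← C_mul, ← mul_assoc, signAt_mul_self, one_mul]
  · rw [evalVar_X_of_ne hk, signPoly, aeval_X, map_mul, evalVar_X_of_ne hk, algHom_C, algebraMap_eq]

lemma signSubst_mem_regularAt {i : b.support} {c : ℂ} (j : b.support) {f : RatFun b.support}
    (hf : f ∈ regularAt i c) : signSubst b j f ∈ regularAt i (signAt b j i * c) := by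
  obtain ⟨v, hv, u, hu⟩ := mem_regularAt.mp hf
  change algebraMap (MvPolynomial b.support ℂ) (RatFun b.support) u = _ at hu
  refine mem_regularAt.mpr ⟨signPoly b j v, ?_, signPoly b j u, ?_⟩
  · rw [evalVar_signPoly]
    exact fun h ↦ hv (signPoly_injective j (by rw [h, map_zero]))
  · change algebraMap (MvPolynomial b.support ℂ) (RatFun b.support) _ = _
    rw [algebraMap_signPoly, algebraMap_signPoly, hu, map_mul]

variable (b q) in
/-- The rational functions regular at the generic points of all `y_i = 1` and `y_i = -1`. -/
def regularAtSimple : Subalgebra ℂ (RatFun b.support) :=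
  ⨅ i : b.support, regularAt i (1 / (Real.sqrt q : ℂ)) ⊓ regularAt i (-1 / (Real.sqrt q : ℂ))

omit [Finite ι] [P.IsCrystallographic] in
lemma mem_regularAtSimple {f : RatFun b.support} : f ∈ regularAtSimple b q ↔
    ∀ (i : b.support) (c : ℂ), c = 1 ∨ c = -1 → f ∈ regularAt i (c / (Real.sqrt q : ℂ)) := by
  simp only [regularAtSimple, Algebra.mem_iInf, Algebra.mem_inf]
  constructor
  · rintro h i c (rfl | rfl)
    · exact (h i).1
    · exact (h i).2
  · exact fun h i ↦ ⟨h i 1 (Or.inl rfl), h i (-1) (Or.inr rfl)⟩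

/-- `ε_j` at most exchanges `y_i = 1` and `y_i = -1`, which is why both are imposed together. -/
lemma signSubst_mem_regularAtSimple (j : b.support) {f : RatFun b.support}
    (hf : f ∈ regularAtSimple b q) : signSubst b j f ∈ regularAtSimple b q := by
  rw [mem_regularAtSimple] at hf ⊢
  intro i c hc
  have h : signAt b j i * c = 1 ∨ signAt b j i * c = -1 := by
    rw [signAt]
    rcases hc with rfl | rfl <;> split_ifs <;> norm_num
  have := signSubst_mem_regularAt j (hf i _ h)
  rwa [← mul_div_assoc, ← mul_assoc, signAt_mul_self, one_mul] at this

omit [Finite ι] [P.IsCrystallographic] in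
lemma laurent_le_regularAtSimple (hq : q ≠ 0) : laurent b.support ≤ regularAtSimple b q := by
  intro f hf
  rw [mem_regularAtSimple]
  intro i c hc
  refine laurent_le_regularAt i (div_ne_zero ?_ (sqrt_ne_zero hq)) hf
  rcases hc with rfl | rfl <;> norm_num

omit [Finite ι] [P.IsCrystallographic] in
lemma rootMonomial_reflectionPerm_self (a : ι) :
    rootMonomial b q (P.reflectionPerm a a) = (rootMonomial b q a)⁻¹ := by
  rw [rootMonomial, rootMonomial, ← scaledMonomial_neg]
  congr 1
  apply Subtype.ext
  change P.root _ = - P.root _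
  rw [root_reflectionPerm, reflection_apply_self]

omit [P.IsCrystallographic] in
-- For positive `a` this rests on `1/q ≠ 1`. A negative root reduces to its opposite by `1 - Y⁻²/q =
-- -(1 - q Y²)/(q Y²)`, where `q ≠ 1` is used.
lemma rootFactor_inv_mem_regularAtSimple (hq : IsPrimePow q) (a : ι) :
    (rootFactor b q (q : ℂ)⁻¹ a)⁻¹ ∈ regularAtSimple b q := by
  have hq0 : (q : ℂ) ≠ 0 := Nat.cast_ne_zero.mpr hq.ne_zero
  have hq1 : (q : ℂ) ≠ 1 := by exact_mod_cast hq.one_lt.ne'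
  have key : ∀ (a : ι) (κ : ℂ), b.IsPos a → κ ≠ 1 →
      (rootFactor b q κ a)⁻¹ ∈ regularAtSimple b q := by
    intro a κ ha hκ
    rw [mem_regularAtSimple]
    intro i c hc
    refine rootFactor_inv_mem_regularAt hq.ne_zero ha (Or.inr ?_)
    rcases hc with rfl | rfl <;> simpa using hκ
  by_cases ha : b.IsPos a
  · exact key a _ ha (by simpa using hq1)
  · have ha' : b.IsPos (P.reflectionPerm a a) := (Base.IsPos.neg_iff_not b a).mpr ha
    have hY : rootMonomial b q a = (rootMonomial b q (P.reflectionPerm a a))⁻¹ := by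
      rw [rootMonomial_reflectionPerm_self, inv_inv]
    have h0 := rootMonomial_ne_zero (b := b) hq.ne_zero (P.reflectionPerm a a)
    have hc : (q : RatFun b.support) ≠ 0 := Nat.cast_ne_zero.mpr hq.ne_zero
    have h1 : (rootFactor b q (q : ℂ)⁻¹ a)⁻¹ = algebraMap ℂ _ (-(q : ℂ)) *
        rootMonomial b q (P.reflectionPerm a a) ^ 2 *
          (rootFactor b q (q : ℂ) (P.reflectionPerm a a))⁻¹ := by
      have h2 := rootFactor_ne_zero (q := q) (q : ℂ) ha'
      rw [rootFactor, hY]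
      rw [rootFactor] at h2 ⊢
      rw [map_inv₀, map_neg, map_natCast] at *
      generalize rootMonomial b q (P.reflectionPerm a a) = Y at *
      have h3 : 1 - (q : RatFun b.support)⁻¹ * Y⁻¹ ^ 2 =
          (1 - q * Y ^ 2) / (-q * Y ^ 2) := by
        field_simp
        ring
      rw [h3, inv_div, div_eq_mul_inv]
    rw [h1]
    exact mul_mem (mul_mem (Subalgebra.algebraMap_mem _ _) (pow_mem
      (laurent_le_regularAtSimple hq.ne_zero (rootMonomial_mem_laurent _)) 2)) (key _ _ ha' hq1)

end Sign

/-! ### Absence of poles of `f` along the simple divisors -/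

section Poles

open MvPolynomial

variable {ι M N : Type*} [Fintype ι] [AddCommGroup M] [Module ℝ M] [AddCommGroup N] [Module ℝ N]
  {P : RootPairing ι ℝ M N} [P.IsCrystallographic] [P.IsReduced] {b : P.Base}
  (hsl : b.cartanMatrix.IsSimplyLaced) {q : ℕ} (hq : IsPrimePow q) (l : b.support → ℕ)

include hsl

/-- Along `y_i = c`, `D` is a unit and `Δ` is `y_i - c` times a unit, so divisibility of `D Δ f` by
`y_i - c` is regularity of `f`. -/
lemma mem_regularAtSimple_of_invariant {f : RatFun b.support}
    (hf : ∀ i, simpleSlash b hq l i f = f)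
    (hpoly : denom b q * Delta b q * f ∈ polynomials b.support) : f ∈ regularAtSimple b q := by
  classical
  rw [mem_regularAtSimple]
  intro i c hc
  obtain ⟨h, hh, e⟩ := exists_eq_sub_mul hsl hq l (hf i) hpoly hc
  have hc0 : c ≠ 0 := by rcases hc with rfl | rfl <;> norm_num
  have hcc : algebraMap ℂ (RatFun b.support) c * algebraMap ℂ (RatFun b.support) c = 1 := by
    rcases hc with rfl | rfl <;> simp
  have hD := denom_ne_zero (b := b) hq.ne_zero
  have hΔ := Delta_ne_zero (b := b) hq.ne_zero
  have hDinv : (denom b q)⁻¹ ∈ regularAt i (c / (Real.sqrt q : ℂ)) := by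
    rw [denom_eq hq.ne_zero, ← Finset.prod_inv_distrib]
    exact prod_mem fun a _ ↦ mem_regularAtSimple.mp (rootFactor_inv_mem_regularAtSimple hq a) i c hc
  have hΔinv : (∏ a ∈ (posRoots b).erase (i : ι), rootFactor b q 1 a)⁻¹ ∈
      regularAt i (c / (Real.sqrt q : ℂ)) := by
    rw [← Finset.prod_inv_distrib]
    refine prod_mem fun a ha ↦ ?_
    rw [Finset.mem_erase, mem_posRoots] at ha
    exact rootFactor_inv_mem_regularAt hq.ne_zero ha.2 (Or.inl ha.1)
  have hadd := scaledVar_add_inv_mem_regularAt (b := b) hq.ne_zero (i := i) hc0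
  have hΔeq := Delta_eq (b := b) hq.ne_zero
  rw [prod_posRoots_eq i, map_one, one_mul] at hΔeq
  have hfac : 1 - scaledVar b q i ^ 2 = -((scaledVar b q i - algebraMap ℂ _ c) *
      (scaledVar b q i + algebraMap ℂ _ c)) := by
    linear_combination -hcc
  rw [hfac] at hΔeq
  rw [hΔeq] at e hΔ
  generalize (∏ a ∈ (posRoots b).erase (i : ι), rootFactor b q 1 a) = E at *
  generalize denom b q = D at *
  have hf' : f = -(h * D⁻¹ * E⁻¹ * (scaledVar b q i + algebraMap ℂ _ c)⁻¹) := by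
    have h1 : scaledVar b q i - algebraMap ℂ _ c ≠ 0 := fun h0 ↦ hΔ (by rw [h0]; ring)
    have h2 : scaledVar b q i + algebraMap ℂ _ c ≠ 0 := fun h0 ↦ hΔ (by rw [h0]; ring)
    have h3 : E ≠ 0 := fun h0 ↦ hΔ (by rw [h0]; ring)
    have e' : D * (-(scaledVar b q i + algebraMap ℂ _ c) * E) * f = h :=
      mul_left_cancel₀ h1 (by linear_combination e)
    rw [← e']
    have h4 : D ≠ 0 := hD
    field_simp
  rw [hf']
  exact neg_mem (mul_mem (mul_mem (mul_mem hh hDinv) hΔinv) hadd)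

omit [Fintype ι] [P.IsReduced] in
-- Since `σ_i` inverts `y_i`, reflections preserve Laurent polynomials but not polynomials; the
-- divisor argument therefore runs in `laurent`.
lemma reflectSubst_mem_laurent [Finite ι] (i : b.support) {f : RatFun b.support}
    (hf : f ∈ laurent b.support) : reflectSubst b hq i f ∈ laurent b.support := by
  have hx : ∀ j, (var j : RatFun b.support) =
      algebraMap ℂ _ (Real.sqrt q : ℂ)⁻¹ * scaledVar b q j := by
    intro j
    rw [scaledVar, map_inv₀, sqrtConst, inv_mul_cancel_left₀]
    exact sqrtConst_ne_zero hq.ne_zero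
  refine map_mem_of_mem_laurent _ (fun j ↦ ?_) (fun j ↦ ?_) hf
  · rw [hx, map_mul, AlgHom.commutes, reflectSubst_scaledVar hsl]
    exact mul_mem (Subalgebra.algebraMap_mem _ _) (mul_mem (scaledVar_mem_laurent j)
      (zpow_mem_of_inv_mem (scaledVar_mem_laurent i) (scaledVar_inv_mem_laurent i) _))
  · rw [hx, map_mul, AlgHom.commutes, reflectSubst_scaledVar hsl, mul_inv, mul_inv, ← map_inv₀,
      ← zpow_neg]
    exact mul_mem (Subalgebra.algebraMap_mem _ _) (mul_mem (scaledVar_inv_mem_laurent j)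
      (zpow_mem_of_inv_mem (scaledVar_mem_laurent i) (scaledVar_inv_mem_laurent i) _))

end Poles

/-! ### A reflection-stable algebra containing the coefficients -/

section Coefficients

variable {ι M N : Type*} [Finite ι] [AddCommGroup M] [Module ℝ M] [AddCommGroup N] [Module ℝ N]
  {P : RootPairing ι ℝ M N} {b : P.Base} {q : ℕ}

variable (b q) in
/-- The algebra generated by the root monomials and the inverses of the factors of `D` and of its
Weyl conjugates. -/
def coeffAlgebra : Subalgebra ℂ (RatFun b.support) :=
  Algebra.adjoin ℂ (Set.range (rootMonomial b q) ∪
    Set.range fun a ↦ (rootFactor b q (q : ℂ)⁻¹ a)⁻¹)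

omit [Finite ι] in
lemma rootMonomial_mem_coeffAlgebra (a : ι) : rootMonomial b q a ∈ coeffAlgebra b q :=
  Algebra.subset_adjoin (Or.inl ⟨a, rfl⟩)

omit [Finite ι] in
lemma rootFactor_inv_mem_coeffAlgebra (a : ι) :
    (rootFactor b q (q : ℂ)⁻¹ a)⁻¹ ∈ coeffAlgebra b q :=
  Algebra.subset_adjoin (Or.inr ⟨a, rfl⟩)

omit [Finite ι] in
lemma rootFactor_mem_coeffAlgebra (c : ℂ) (a : ι) : rootFactor b q c a ∈ coeffAlgebra b q :=
  sub_mem (one_mem _) (mul_mem (Subalgebra.algebraMap_mem _ _)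
    (pow_mem (rootMonomial_mem_coeffAlgebra a) 2))

omit [Finite ι] in
lemma coeffAlgebra_le {L : Subalgebra ℂ (RatFun b.support)} (h1 : ∀ a, rootMonomial b q a ∈ L)
    (h2 : ∀ a, (rootFactor b q (q : ℂ)⁻¹ a)⁻¹ ∈ L) : coeffAlgebra b q ≤ L := by
  refine Algebra.adjoin_le ?_
  rintro _ (⟨a, rfl⟩ | ⟨a, rfl⟩)
  · exact h1 a
  · exact h2 a

omit [Finite ι] in
-- The denominator `√q - y_i` divides `q - y_i²`, and `y_i⁻¹` is the monomial of the root `-α_i`.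
lemma slashCoeff_mem_coeffAlgebra (hq : q ≠ 0) (i : b.support) (n : ℕ) :
    slashCoeff (sqrtConst b q) n (scaledVar b q i) ∈ coeffAlgebra b q ∧
      slashTwistCoeff (sqrtConst b q) n (scaledVar b q i) ∈ coeffAlgebra b q := by
  have hy : scaledVar b q i ∈ coeffAlgebra b q :=
    rootMonomial_simple (q := q) i ▸ rootMonomial_mem_coeffAlgebra _
  have hyi : (scaledVar b q i)⁻¹ ∈ coeffAlgebra b q := by
    rw [← rootMonomial_simple, ← rootMonomial_reflectionPerm_self]
    exact rootMonomial_mem_coeffAlgebra _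
  have hs : sqrtConst b q ∈ coeffAlgebra b q := Subalgebra.algebraMap_mem _ _
  have hs0 := sqrtConst_ne_zero (b := b) hq
  have hy0 := scaledVar_ne_zero (b := b) hq i
  have hsy := sqrtConst_sub_scaledVar_ne_zero (b := b) hq i
  have hsy' := sqrtConst_add_scaledVar_ne_zero (b := b) hq i
  have hc : algebraMap ℂ (RatFun b.support) (2 * (q : ℂ))⁻¹ = (2 * sqrtConst b q ^ 2)⁻¹ := by
    rw [map_inv₀, map_mul, map_natCast, map_ofNat, sqrtConst_sq]
  have hF : (rootFactor b q (q : ℂ)⁻¹ (i : ι))⁻¹ = sqrtConst b q ^ 2 /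
      ((sqrtConst b q - scaledVar b q i) * (sqrtConst b q + scaledVar b q i)) := by
    rw [← inv_div, rootFactor, rootMonomial_simple, map_inv₀, map_natCast,
      ← sqrtConst_sq (b := b)]
    congr 1
    field_simp
    ring
  have hd : (2 * scaledVar b q i * (sqrtConst b q - scaledVar b q i))⁻¹ ∈ coeffAlgebra b q := by
    have : (2 * scaledVar b q i * (sqrtConst b q - scaledVar b q i))⁻¹ =
        (2 * sqrtConst b q ^ 2)⁻¹ * (scaledVar b q i)⁻¹ * (sqrtConst b q + scaledVar b q i) *
          (rootFactor b q (q : ℂ)⁻¹ (i : ι))⁻¹ := by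
      rw [hF]
      field_simp
    rw [this]
    exact mul_mem (mul_mem (mul_mem (hc ▸ Subalgebra.algebraMap_mem _ _) hyi) (add_mem hs hy))
      (rootFactor_inv_mem_coeffAlgebra _)
  constructor
  · rw [slashCoeff, div_eq_mul_inv]
    exact mul_mem (pow_mem hy _) (mul_mem (mul_mem (sub_mem hs (one_mem _))
      (add_mem (one_mem _) hy)) hd)
  · rw [slashTwistCoeff, div_eq_mul_inv]
    exact mul_mem (pow_mem hy _) (mul_mem (mul_mem (mul_mem (pow_mem (neg_mem (one_mem _)) _)
      (add_mem hs (one_mem _))) (sub_mem hy (one_mem _))) hd)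

variable [P.IsCrystallographic]

omit [P.IsCrystallographic] in
lemma coeffAlgebra_le_regularAtSimple (hq : IsPrimePow q) :
    coeffAlgebra b q ≤ regularAtSimple b q :=
  coeffAlgebra_le
    (fun a ↦ laurent_le_regularAtSimple hq.ne_zero (rootMonomial_mem_laurent a))
    (rootFactor_inv_mem_regularAtSimple hq)

variable (hsl : b.cartanMatrix.IsSimplyLaced) (hq : IsPrimePow q)

include hsl

lemma reflectSubst_mem_coeffAlgebra (i : b.support) {g : RatFun b.support}
    (hg : g ∈ coeffAlgebra b q) : reflectSubst b hq i g ∈ coeffAlgebra b q := by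
  suffices h : coeffAlgebra b q ≤ (coeffAlgebra b q).comap (reflectSubst b hq i) from h hg
  refine coeffAlgebra_le (fun a ↦ ?_) fun a ↦ ?_ <;> rw [Subalgebra.mem_comap]
  · rw [reflectSubst_rootMonomial hsl]
    exact rootMonomial_mem_coeffAlgebra _
  · rw [map_inv₀, reflectSubst_rootFactor hsl]
    exact rootFactor_inv_mem_coeffAlgebra _

lemma signSubst_mem_coeffAlgebra (i : b.support) {g : RatFun b.support}
    (hg : g ∈ coeffAlgebra b q) : signSubst b i g ∈ coeffAlgebra b q := by
  suffices h : coeffAlgebra b q ≤ (coeffAlgebra b q).comap (signSubst b i) from h hg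
  refine coeffAlgebra_le (fun a ↦ ?_) fun a ↦ ?_ <;> rw [Subalgebra.mem_comap]
  · have h0 := rootMonomial_mem_coeffAlgebra (b := b) (q := q) a
    rw [rootMonomial] at h0 ⊢
    rcases signSubst_scaledMonomial hsl (q := q) i (P.rootSpanMem ℤ a) with h | h <;> rw [h]
    · exact h0
    · exact neg_mem h0
  · rw [map_inv₀, signSubst_rootFactor hsl]
    exact rootFactor_inv_mem_coeffAlgebra _

/-- Thus `σ_j` normalizes the group of sign changes. -/
lemma reflectSubst_signSubst (i j : b.support) (f : RatFun b.support) :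
    reflectSubst b hq j (signSubst b i f) = signSubst b i (reflectSubst b hq j f) ∨
      reflectSubst b hq j (signSubst b i f) =
        signSubst b i (signSubst b j (reflectSubst b hq j f)) := by
  by_cases hij : j = i
  · subst hij
    exact Or.inl (signSubst_reflectSubst_self hsl hq j f).symm
  · rcases hsl hij with h | h
    · exact Or.inl (signSubst_reflectSubst_of_orthogonal hsl hq
        (b.cartanMatrix_apply_eq_zero_iff_symm.mp h) f).symm
    · right
      rw [signSubst_reflectSubst_self hsl, signSubst_reflectSubst_of_adjacent hsl hq h,
        signSubst_signSubst hsl]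

end Coefficients

/-! ### From simple divisors to the divisors of all positive roots -/

section Orbit

variable {ι M N : Type*} [Finite ι] [AddCommGroup M] [Module ℝ M] [AddCommGroup N] [Module ℝ N]
  {P : RootPairing ι ℝ M N} [P.IsCrystallographic] {b : P.Base} {q : ℕ}

variable (b) in
/-- The functions obtained from `f` by sign substitutions. -/
inductive SignOrbit (f : RatFun b.support) : RatFun b.support → Prop
  | refl : SignOrbit f f
  | signSubst (i : b.support) {g : RatFun b.support} (hg : SignOrbit f g) :
      SignOrbit f (signSubst b i g)

variable (b q) in
/-- The algebra generated by `coeffAlgebra` and all sign substitutions of `f`. -/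
def orbitAlgebra (f : RatFun b.support) : Subalgebra ℂ (RatFun b.support) :=
  Algebra.adjoin ℂ (coeffAlgebra b q ∪ {g | SignOrbit b f g})

lemma mem_orbitAlgebra_of_mem_coeffAlgebra {f g : RatFun b.support} (hg : g ∈ coeffAlgebra b q) :
    g ∈ orbitAlgebra b q f := Algebra.subset_adjoin (Or.inl hg)

lemma SignOrbit.mem_orbitAlgebra {f g : RatFun b.support} (hg : SignOrbit b f g) :
    g ∈ orbitAlgebra b q f := Algebra.subset_adjoin (Or.inr hg)

lemma orbitAlgebra_le_regularAtSimple (hq : IsPrimePow q) {f : RatFun b.support}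
    (hf : f ∈ regularAtSimple b q) : orbitAlgebra b q f ≤ regularAtSimple b q := by
  refine Algebra.adjoin_le ?_
  rintro g (hg | hg)
  · exact coeffAlgebra_le_regularAtSimple hq hg
  · induction hg with
    | refl => exact hf
    | signSubst i hg ih => exact signSubst_mem_regularAtSimple i ih

variable (hsl : b.cartanMatrix.IsSimplyLaced) (hq : IsPrimePow q) (l : b.support → ℕ)

include hsl

lemma signSubst_mem_orbitAlgebra (i : b.support) {f g : RatFun b.support}
    (hg : g ∈ orbitAlgebra b q f) : signSubst b i g ∈ orbitAlgebra b q f := by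
  suffices h : orbitAlgebra b q f ≤ (orbitAlgebra b q f).comap (signSubst b i) from h hg
  refine Algebra.adjoin_le ?_
  rintro g (hg | hg)
  · exact mem_orbitAlgebra_of_mem_coeffAlgebra (signSubst_mem_coeffAlgebra hsl i hg)
  · exact (hg.signSubst i).mem_orbitAlgebra

/-- Applying `σ_j` to `f = f|σ_j` writes `σ_j f` through `f` and `ε_j f` with coefficients in
`coeffAlgebra`; for the rest of the orbit, `σ_j` is moved past the sign changes. -/
lemma reflectSubst_mem_orbitAlgebra {f : RatFun b.support}
    (hf : ∀ i, simpleSlash b hq l i f = f) (j : b.support) {g : RatFun b.support}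
    (hg : g ∈ orbitAlgebra b q f) : reflectSubst b hq j g ∈ orbitAlgebra b q f := by
  suffices h : orbitAlgebra b q f ≤ (orbitAlgebra b q f).comap (reflectSubst b hq j) from h hg
  refine Algebra.adjoin_le ?_
  rintro g (hg | hg)
  · exact mem_orbitAlgebra_of_mem_coeffAlgebra (reflectSubst_mem_coeffAlgebra hsl hq j hg)
  · rw [SetLike.mem_coe, Subalgebra.mem_comap]
    induction hg with
    | refl =>
      have h := congrArg (reflectSubst b hq j) (hf j)
      rw [simpleSlash_eq, map_add, map_mul, map_mul, reflectSubst_reflectSubst hsl,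
        reflectSubst_reflectSubst hsl] at h
      obtain ⟨h1, h2⟩ := slashCoeff_mem_coeffAlgebra hq.ne_zero j (l j)
      rw [← h]
      exact add_mem
        (mul_mem (mem_orbitAlgebra_of_mem_coeffAlgebra (reflectSubst_mem_coeffAlgebra hsl hq j h1))
          SignOrbit.refl.mem_orbitAlgebra)
        (mul_mem (mem_orbitAlgebra_of_mem_coeffAlgebra (reflectSubst_mem_coeffAlgebra hsl hq j h2))
          (SignOrbit.refl.signSubst j).mem_orbitAlgebra)
    | signSubst i hg ih =>
      rcases reflectSubst_signSubst hsl hq i j _ with h | h <;> rw [h]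
      · exact signSubst_mem_orbitAlgebra hsl i ih
      · exact signSubst_mem_orbitAlgebra hsl i (signSubst_mem_orbitAlgebra hsl j ih)

/-- Elements of an algebra that is stable under simple reflections and regular along the simple
divisors `y_i² = 1` are regular along the divisors `y_a² = 1` of all positive roots. -/
lemma mem_laurent_of_mul_rootFactor_mem [P.IsReduced] {L : Subalgebra ℂ (RatFun b.support)}
    (hreg : L ≤ regularAtSimple b q)
    (hstab : ∀ i, ∀ g ∈ L, reflectSubst b hq i g ∈ L) {a : ι} (ha : b.IsPos a) :
    ∀ g ∈ L, g * rootFactor b q 1 a ∈ laurent b.support → g ∈ laurent b.support := by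
  refine ha.induction_on_reflect (p := fun a ↦ ∀ g ∈ L, g * rootFactor b q 1 a ∈
    laurent b.support → g ∈ laurent b.support) (fun i hi g hg h ↦ ?_) fun a j ih hj g hg h ↦ ?_
  · lift i to b.support using hi
    have hs := sqrt_ne_zero hq.ne_zero
    have hdiv : ∀ c : ℂ, c = 1 ∨ c = -1 → ∀ u ∈ regularAtSimple b q,
        u * (scaledVar b q i - algebraMap ℂ _ c) ∈ laurent b.support → u ∈ laurent b.support := by
      intro c hc u hu hlu
      refine mem_laurent_of_mem_regularAt (mem_regularAtSimple.mp hu i c hc) ?_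
      have h2 := mul_mem (Subalgebra.algebraMap_mem _ (Real.sqrt q : ℂ)⁻¹) hlu
      rw [scaledVar_sub_algebraMap hq.ne_zero] at h2
      convert h2 using 1
      rw [mul_left_comm, ← mul_assoc (algebraMap ℂ _ _), ← map_mul, inv_mul_cancel₀ hs, map_one,
        one_mul]
    -- `1 - y_i² = -(y_i - 1)(y_i + 1)`: the factor `y_i + 1` is removed first, then `y_i - 1`.
    refine hdiv 1 (Or.inl rfl) g (hreg hg) (hdiv (-1) (Or.inr rfl) _ (mul_mem (hreg hg) ?_) ?_)
    · exact laurent_le_regularAtSimple hq.ne_zero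
        (sub_mem (scaledVar_mem_laurent i) (Subalgebra.algebraMap_mem _ _))
    · have h2 := neg_mem h
      rw [rootFactor, rootMonomial_simple, map_one] at h2
      rw [map_neg, map_one]
      convert h2 using 1
      ring
  · lift j to b.support using hj
    -- `σ_j` turns the hypothesis on `g` at `s_j a` into the one on `σ_j g`, still in `L`, at `a`; a
    -- second `σ_j` recovers `g`.
    have h2 := reflectSubst_mem_laurent hsl hq j h
    rw [map_mul, reflectSubst_rootFactor hsl, P.reflectionPerm_self] at h2
    rw [← reflectSubst_reflectSubst hsl hq j g]
    exact reflectSubst_mem_laurent hsl hq j (ih _ (hstab j g hg) h2)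

end Orbit

/-! ### Conclusion: `f D` is a polynomial -/

section Polynomial

variable {ι M N : Type*} [Fintype ι] [AddCommGroup M] [Module ℝ M] [AddCommGroup N] [Module ℝ N]
  {P : RootPairing ι ℝ M N} [P.IsCrystallographic] [P.IsReduced] {b : P.Base}
  (hsl : b.cartanMatrix.IsSimplyLaced) {q : ℕ} (hq : IsPrimePow q) (l : b.support → ℕ)

include hsl

/-- The factors of `Δ` are stripped from `D Δ f` one by one, every partial product staying in
`orbitAlgebra`. -/
lemma mul_denom_mem_polynomials {f : RatFun b.support} (hf : ∀ i, simpleSlash b hq l i f = f)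
    (hpoly : denom b q * Delta b q * f ∈ polynomials b.support) :
    f * denom b q ∈ polynomials b.support := by
  have hfreg := mem_regularAtSimple_of_invariant hsl hq l hf hpoly
  have hF : ∀ c a, rootFactor b q c a ∈ orbitAlgebra b q f := fun c a ↦
    mem_orbitAlgebra_of_mem_coeffAlgebra (rootFactor_mem_coeffAlgebra c a)
  have hfD : f * denom b q ∈ orbitAlgebra b q f := by
    rw [denom_eq hq.ne_zero]
    exact mul_mem SignOrbit.refl.mem_orbitAlgebra (prod_mem fun a _ ↦ hF _ a)
  have hremove : ∀ s ⊆ posRoots b,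
      f * denom b q * ∏ a ∈ s, rootFactor b q 1 a ∈ laurent b.support →
        f * denom b q ∈ laurent b.support := by
    intro s
    induction s using Finset.cons_induction with
    | empty => simp
    | cons a s ha ih =>
      intro hs h
      rw [Finset.cons_subset] at hs
      refine ih hs.2 (mem_laurent_of_mul_rootFactor_mem hsl hq
        (orbitAlgebra_le_regularAtSimple hq hfreg)
        (fun i g hg ↦ reflectSubst_mem_orbitAlgebra hsl hq l hf i hg) (mem_posRoots.mp hs.1) _
        (mul_mem hfD (prod_mem fun a _ ↦ hF _ a)) ?_)
      rwa [Finset.prod_cons, mul_left_comm, mul_comm] at h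
  refine mem_polynomials_of_mem_laurent (hremove _ subset_rfl ?_) fun i ↦ ?_
  · rw [← Delta_eq hq.ne_zero]
    convert polynomials_le_laurent hpoly using 1
    ring
  · have hΔ := Delta_ne_zero (b := b) hq.ne_zero
    have : f * denom b q = denom b q * Delta b q * f * (Delta b q)⁻¹ := by
      field_simp
    rw [this]
    exact mul_mem (polynomials_le_regularAt i 0 hpoly) (Delta_inv_mem_regularAt_zero hq.ne_zero i)

end Polynomial

end TwistedWeyl

end

theorem theorem2p4 {ι M N : Type*} [Fintype ι] [AddCommGroup M] [Module ℝ M]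
    [AddCommGroup N] [Module ℝ N] (P : RootPairing ι ℝ M N)
    [P.IsRootSystem] [P.IsCrystallographic] [P.IsReduced]
    (b : P.Base) (hsl : b.cartanMatrix.IsSimplyLaced)
    (q : ℕ) (hq : IsPrimePow q) (l : b.support → ℕ) :
    (∃! S : P.weylGroup → TwistedWeyl.RatFun b.support → TwistedWeyl.RatFun b.support,
      TwistedWeyl.IsRightActionExtending b (fun i f ↦ TwistedWeyl.reflectSubst b hq i f) S) ∧
    (∃! A : P.weylGroup → TwistedWeyl.RatFun b.support → TwistedWeyl.RatFun b.support,
      TwistedWeyl.IsRightActionExtending b (TwistedWeyl.simpleSlash b hq l) A) ∧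
    ∀ S A : P.weylGroup → TwistedWeyl.RatFun b.support → TwistedWeyl.RatFun b.support,
      TwistedWeyl.IsRightActionExtending b (fun i f ↦ TwistedWeyl.reflectSubst b hq i f) S →
      TwistedWeyl.IsRightActionExtending b (TwistedWeyl.simpleSlash b hq l) A →
      ∃ p : MvPolynomial b.support ℂ,
        TwistedWeyl.average b q S A =
          algebraMap (MvPolynomial b.support ℂ) (TwistedWeyl.RatFun b.support) p /
            TwistedWeyl.denom b q := by
  have hS₀ := TwistedWeyl.isRightActionExtending_descentLift hsl
    (TwistedWeyl.reflectSubst_reflectSubst hsl hq)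
    (fun i j _ h ↦ TwistedWeyl.reflectSubst_comm_of_orthogonal hsl hq h)
    (fun i j hij h ↦ TwistedWeyl.reflectSubst_braid hsl hq h
      (TwistedWeyl.cartanMatrix_symm hsl hij h))
  have hA₀ := TwistedWeyl.isRightActionExtending_descentLift hsl
    (TwistedWeyl.simpleSlash_simpleSlash hsl hq l)
    (fun i j _ h ↦ TwistedWeyl.simpleSlash_comm hsl hq l h)
    (fun i j hij h ↦ TwistedWeyl.simpleSlash_braid hsl hq l h
      (TwistedWeyl.cartanMatrix_symm hsl hij h))
  refine ⟨⟨_, hS₀, fun S hS ↦ hS.unique hS₀⟩, ⟨_, hA₀, fun A hA ↦ hA.unique hA₀⟩,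
    fun S A hS hA ↦ ?_⟩
  obtain ⟨p, hp⟩ := TwistedWeyl.mem_polynomials.mp (TwistedWeyl.mul_denom_mem_polynomials hsl hq l
    (TwistedWeyl.simpleSlash_average hsl hq l hS hA)
    (TwistedWeyl.denom_mul_Delta_mul_average_mem hsl hq l hS hA))
  exact ⟨p, by rw [hp, mul_div_cancel_right₀ _ (TwistedWeyl.denom_ne_zero hq.ne_zero)]⟩
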